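/- \textbf{Lemma (Energy-stable variational formulation).} Let $d\in\{2,3\}$, $T>0$, and let $\rho_1,\rho_2,\eta_1,\eta_2,\gamma,g\in\mathbb R$ with $\rho_1+\rho_2>0$, a vertical unit vector $\mathbf j\in\mathbb R^d$, a potential $f\in C^1(\mathbb R)$ and a mobility tensor $\mathbf M\in C^1(\mathbb R;\mathbb R^{d\times d})$ be given. Put $y(\mathbf x)=\mathbf j\cdot\mathbf x$, $\rho(\phi)=\rho_1\frac{1+\phi}2+\rho_2\frac{1-\phi}2$, $\eta(\phi)=\eta_1\frac{1+\phi}2+\eta_2\frac{1-\phi}2$, $\alpha=\frac{\rho_2-\rho_1}{\rho_1+\rho_2}$ and $\mathbf S(\phi,\nabla\mathbf v)=\eta(\phi)\big(\nabla\mathbf v+(\nabla\mathbf v)^T-\tfrac2d(\operatorname{div}\mathbf v)\mathbf I\big)$. Let $(\phi,\mathbf v,\mu,p)$ be a solution, smooth on $(0,T)\times\overline\Omega$, of the reformulated Navier--Stokes Cahn--Hilliard system \begin{align*} \operatorname{div}\mathbf v-\alpha\operatorname{div}\big(\mathbf M(\phi)\nabla(\mu+\alpha p)\big)&=0,\\ \tfrac{\mathbf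 v}2\partial_t\rho+\rho\,\partial_t\mathbf v+\tfrac12\mathbf v\operatorname{div}(\rho\mathbf v)+\rho\mathbf v\cdot\nabla\mathbf v-\operatorname{div}\mathbf S+\nabla p+\phi\nabla\mu&=-\rho g\,\mathbf j,\\ \partial_t\phi+\operatorname{div}(\phi\mathbf v)-\operatorname{div}\big(\mathbf M(\phi)\nabla(\mu+\alpha p)\big)&=0,\\ \mu+\gamma\Delta\phi-f'(\phi)&=0 \end{align*} in $(0,T)\times\Omega$, where $\rho=\rho(\phi)$, under one of the following sets of boundary conditions. \begin{itemize} \item[(W)] $\Omega\subset\mathbb R^d$ is a bounded Lipschitz domain (connectedness is not needed) and $\partial\Omega=\Gamma_1\cup\Gamma_2$. At every boundary point with an outward unit normal $\mathbf n$: $\nabla\phi\cdot\mathbf n=\mathbf M(\phi)\nabla(\mu+\alpha p)\cdot\mathbf n=0$. Moreover $\mathbf v=\mathbf 0$ on $\Gamma_1$, and at every point of $\Gamma_2$ with an outward unit normal $\mathbf v\cdot\mathbf n=0$ and the tangential part of $\mathbf S\mathbf n$ vanishes (free slip). \item[(P)] $\Omega$ is a hypercube of side $L>0$ and $\phi,\mathbf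 v,\mu,p$ are smooth and $L$-periodic in each coordinate direction on $\mathbb R^d$. \end{itemize} Write $\langle a,b\rangle=\int_\Omega a\cdot b$ and $\mathbf c_{skw}(\mathbf u,\mathbf v,\mathbf w)=\frac12\langle(\mathbf u\cdot\nabla)\mathbf v,\mathbf w\rangle-\frac12\langle(\mathbf u\cdot\nabla)\mathbf w,\mathbf v\rangle$. Then for every $t\in(0,T)$ \begin{align*} \langle\partial_t\phi,\psi\rangle-\langle\phi\mathbf v,\nabla\psi\rangle+\langle\mathbf M(\phi)\nabla(\mu+\alpha p),\nabla\psi\rangle&=0,\\ \langle\mu,\xi\rangle-\gamma\langle\nabla\phi,\nabla\xi\rangle-\langle f'(\phi),\xi\rangle&=0,\\ \langle\tfrac{\mathbf v}2\partial_t\rho+\rho\,\partial_t\mathbf v,\mathbf w\rangle+\mathbf c_{skw}(\rho\mathbf v,\mathbf v,\mathbf w)+\langle\mathbf S(\phi,\nabla\mathbf v),\nabla\mathbf w\rangle-\langle p,\operatorname{div}\mathbf w\rangle+\langle\phi\nabla\mu,\mathbf w\rangle+\langle\rho(\phi)g\,\mathbf j,\mathbf w\rangle&=0,\\ \langle\operatorname{div}\mathbf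 v,q\rangle+\alpha\langle\mathbf M(\phi)\nabla(\mu+\alpha p),\nabla q\rangle&=0 \end{align*} for all smooth test functions $\psi,\xi,\mathbf w,q$ on $\overline\Omega$ with $\langle q,1\rangle=0$, where in case (W) $\mathbf w=\mathbf 0$ on $\Gamma_1$ and $\mathbf w\cdot\mathbf n=0$ wherever $\mathbf n$ exists on $\Gamma_2$, and in case (P) all test functions are $L$-periodic. Furthermore, for every $t\in(0,T)$, \[ \tfrac{\mathrm d}{\mathrm dt}\langle\phi(t),1\rangle=0,\qquad \tfrac{\mathrm d}{\mathrm dt}\langle\rho(\phi(t)),1\rangle=0, \] and, in case (W) for every $g$ and in case (P) if $g=0$, \[ \tfrac{\mathrm d}{\mathrm dt}\mathcal E(\phi(t),\mathbf v(t))=-\mathcal D_{\phi(t)}\big(\mu(t)+\alpha p(t),\mathbf v(t)\big), \] where $\mathcal E(\phi,\mathbf v)=\int_\Omega\frac\gamma2|\nabla\phi|^2+f(\phi)+\frac{\rho(\phi)}2|\mathbf v|^2+g\rho(\phi)y$ and $\mathcal D_\phi(\chi,\mathbf v)=\int_\Omega\nabla\chi\cdot\mathbf M(\phi)\nabla\chi+\mathbf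 S(\phi,\nabla\mathbf v):\nabla\mathbf v$. -/

import Mathlib

open Set Filter Topology MeasureTheory
open scoped ContDiff

noncomputable section

namespace NSCH

/-- Euclidean space `ℝ^d`. -/
abbrev Vec (d : ℕ) : Type := EuclideanSpace ℝ (Fin d)

/-! ### Vector calculus -/

/-- The `k`-th standard basis vector. -/
def stdVec {d : ℕ} (k : Fin d) : Vec d := EuclideanSpace.single k (1 : ℝ)

/-- Divergence of a vector field, `∑ₖ ∂ₖ Fₖ`. -/
def vdiv {d : ℕ} (F : Vec d → Vec d) (x : Vec d) : ℝ :=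
  ∑ k : Fin d, (fderiv ℝ F x (stdVec k)) k

/-- Row-wise divergence of a tensor field, `(div A)ᵢ = ∑ₖ ∂ₖ Aᵢₖ`. -/
def tdiv {d : ℕ} (A : Vec d → Vec d →L[ℝ] Vec d) (x : Vec d) : Vec d :=
  ∑ k : Fin d, fderiv ℝ (fun z => A z (stdVec k)) x (stdVec k)

/-- Laplacian `div ∇ u`. -/
def lap {d : ℕ} (u : Vec d → ℝ) (x : Vec d) : ℝ :=
  vdiv (fun z => gradient u z) x

/-- Double contraction `A : B = ∑ᵢₖ Aᵢₖ Bᵢₖ`. -/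
def ddot {d : ℕ} (A B : Vec d →L[ℝ] Vec d) : ℝ :=
  ∑ k : Fin d, inner ℝ (A (stdVec k)) (B (stdVec k))

/-- `⟨a, b⟩ = ∫_Ω a · b` for scalar or vector fields. -/
def pair {d : ℕ} {F : Type} [NormedAddCommGroup F] [InnerProductSpace ℝ F]
    (Ω : Set (Vec d)) (a b : Vec d → F) : ℝ :=
  ∫ x in Ω, inner ℝ (a x) (b x)

/-- `⟨A, B⟩ = ∫_Ω A : B` for tensor fields. -/
def tpair {d : ℕ} (Ω : Set (Vec d)) (A B : Vec d → Vec d →L[ℝ] Vec d) : ℝ :=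
  ∫ x in Ω, ddot (A x) (B x)

/-- `c_skw(u, v, w) = ½⟨(u·∇)v, w⟩ - ½⟨(u·∇)w, v⟩`. -/
def cskw {d : ℕ} (Ω : Set (Vec d)) (u v w : Vec d → Vec d) : ℝ :=
  1 / 2 * pair Ω (fun x => fderiv ℝ v x (u x)) w
    - 1 / 2 * pair Ω (fun x => fderiv ℝ w x (u x)) v

/-! ### Data of the model -/

/-- Constants and constitutive functions: densities, viscosities, surface parameter `γ`,
gravitational constant `g`, vertical unit vector `j`, potential `f` and mobility tensor `M`. -/
structure Data (d : ℕ) where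
  ρ₁ : ℝ
  ρ₂ : ℝ
  η₁ : ℝ
  η₂ : ℝ
  γ : ℝ
  g : ℝ
  j : Vec d
  f : ℝ → ℝ
  M : ℝ → Vec d →L[ℝ] Vec d
  density_pos : 0 < ρ₁ + ρ₂
  norm_j : ‖j‖ = 1
  f_smooth : ContDiff ℝ 1 f
  M_smooth : ContDiff ℝ 1 M

variable {d : ℕ}

/-- Mixture density `ρ(s)`. -/
def Data.ρ (P : Data d) (s : ℝ) : ℝ := P.ρ₁ * ((1 + s) / 2) + P.ρ₂ * ((1 - s) / 2)

/-- Mixture viscosity `η(s)`. -/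
def Data.η (P : Data d) (s : ℝ) : ℝ := P.η₁ * ((1 + s) / 2) + P.η₂ * ((1 - s) / 2)

/-- `α = (ρ₂ - ρ₁) / (ρ₁ + ρ₂)`. -/
def Data.α (P : Data d) : ℝ := (P.ρ₂ - P.ρ₁) / (P.ρ₁ + P.ρ₂)

/-- Vertical coordinate `y`, so that `∇y = j`. -/
def Data.y (P : Data d) (x : Vec d) : ℝ := inner ℝ P.j x

/-- Stress `S = η(φ) (2 ∇ˢv + λ (div v) I)` with `2 ∇ˢv = ∇v + (∇v)ᵀ` and `λ = -2/d`. -/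
def Data.stress (P : Data d) (φ : Vec d → ℝ) (v : Vec d → Vec d) (x : Vec d) :
    Vec d →L[ℝ] Vec d :=
  P.η (φ x) • (fderiv ℝ v x + ContinuousLinearMap.adjoint (fderiv ℝ v x)
    + ((-2 / (d : ℝ)) * vdiv v x) • ContinuousLinearMap.id ℝ (Vec d))

/-- The field `M(φ) ∇χ`. -/
def Data.flux (P : Data d) (φ χ : Vec d → ℝ) (x : Vec d) : Vec d :=
  P.M (φ x) (gradient χ x)

/-- `μ + α p`. -/
def Data.pot (P : Data d) (μ p : Vec d → ℝ) (x : Vec d) : ℝ := μ x + P.α * p x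

/-- Energy `E(φ, v) = ∫_Ω γ/2 |∇φ|² + f(φ) + ρ(φ)/2 |v|² + g ρ(φ) y`. -/
def Data.energy (P : Data d) (Ω : Set (Vec d)) (φ : Vec d → ℝ) (v : Vec d → Vec d) : ℝ :=
  ∫ x in Ω, (P.γ / 2 * ‖gradient φ x‖ ^ 2 + P.f (φ x)
    + P.ρ (φ x) / 2 * ‖v x‖ ^ 2 + P.g * P.ρ (φ x) * P.y x)

/-- Dissipation `D_φ(χ, v) = ∫_Ω ∇χ · M(φ)∇χ + S(φ, ∇v) : ∇v`. -/
def Data.dissipation (P : Data d) (Ω : Set (Vec d)) (φ χ : Vec d → ℝ) (v : Vec d → Vec d) : ℝ :=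
  ∫ x in Ω, (inner ℝ (gradient χ x) (P.M (φ x) (gradient χ x))
    + ddot (P.stress φ v x) (fderiv ℝ v x))

/-! ### Strong solutions -/

/-- Smoothness of a field on `(0,T) × Ω̄`, expressed as usual by being given as the restriction
of a field that is smooth on `(0,T) × ℝ^d`. -/
def SmoothField {F : Type} [NormedAddCommGroup F] [NormedSpace ℝ F] (T : ℝ)
    (u : ℝ → Vec d → F) : Prop :=
  ContDiffOn ℝ ∞ (fun z : ℝ × Vec d => u z.1 z.2) (Ioo 0 T ×ˢ univ)

/-- `(φ, v, μ, p)` is a smooth solution of the reformulated system on `(0,T) × Ω`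
(without boundary conditions). -/
structure IsSmoothSolution (P : Data d) (T : ℝ) (Ω : Set (Vec d))
    (φ : ℝ → Vec d → ℝ) (v : ℝ → Vec d → Vec d) (μ p : ℝ → Vec d → ℝ) : Prop where
  smooth_φ : SmoothField T φ
  smooth_v : SmoothField T v
  smooth_μ : SmoothField T μ
  smooth_p : SmoothField T p
  eq_div : ∀ t ∈ Ioo 0 T, ∀ x ∈ Ω,
    vdiv (v t) x - P.α * vdiv (P.flux (φ t) (P.pot (μ t) (p t))) x = 0
  eq_mom : ∀ t ∈ Ioo 0 T, ∀ x ∈ Ω,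
    (deriv (fun s => P.ρ (φ s x)) t / 2) • v t x
      + P.ρ (φ t x) • deriv (fun s => v s x) t
      + (1 / 2 * vdiv (fun z => P.ρ (φ t z) • v t z) x) • v t x
      + fderiv ℝ (v t) x (P.ρ (φ t x) • v t x)
      - tdiv (P.stress (φ t) (v t)) x
      + gradient (p t) x
      + φ t x • gradient (μ t) x
    = P.ρ (φ t x) • (-P.g • P.j)
  eq_phase : ∀ t ∈ Ioo 0 T, ∀ x ∈ Ω,
    deriv (fun s => φ s x) t + vdiv (fun z => φ t z • v t z) x
      - vdiv (P.flux (φ t) (P.pot (μ t) (p t))) x = 0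
  eq_chem : ∀ t ∈ Ioo 0 T, ∀ x ∈ Ω,
    μ t x + P.γ * lap (φ t) x - deriv P.f (φ t x) = 0

/-! ### Domains with boundary and wall boundary conditions -/

/-- Bounded Lipschitz domain: bounded, open, and near each boundary point `Ω` is the strict
subgraph, in some direction `e`, of a Lipschitz function `h` that does not depend on the
`e`-component. -/
structure IsBoundedLipschitzDomain (Ω : Set (Vec d)) : Prop where
  isOpen : IsOpen Ω
  isBounded : Bornology.IsBounded Ω
  locally_subgraph : ∀ x ∈ frontier Ω, ∃ e : Vec d, ‖e‖ = 1 ∧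
    ∃ (K : NNReal) (h : Vec d → ℝ), LipschitzWith K h ∧ (∀ z, ∀ s : ℝ, h (z + s • e) = h z) ∧
      ∀ᶠ z in 𝓝 x, (z ∈ Ω ↔ inner ℝ e z < h z)

/-- `ν` is the outward unit normal at the boundary point `x`: to first order at `x`, `Ω` coincides
with the half-space `{z | ν · (z - x) < 0}`. On a Lipschitz domain such a `ν` is unique, and it
exists exactly where the function whose graph is the boundary is differentiable. -/
def IsOutwardNormal (Ω : Set (Vec d)) (x ν : Vec d) : Prop :=
  x ∈ frontier Ω ∧ ‖ν‖ = 1 ∧ ∀ ε > 0, ∀ᶠ z in 𝓝 x,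
    (inner ℝ ν (z - x) < -ε * ‖z - x‖ → z ∈ Ω) ∧
    (ε * ‖z - x‖ < inner ℝ ν (z - x) → z ∉ Ω)

/-- The kinematic conditions `w = 0` on `Γ₁` and `w · n = 0` on `Γ₂`. -/
def NoPenetration (Ω Γ₁ Γ₂ : Set (Vec d)) (w : Vec d → Vec d) : Prop :=
  (∀ x ∈ Γ₁, w x = 0) ∧ ∀ x ∈ Γ₂, ∀ ν, IsOutwardNormal Ω x ν → inner ℝ (w x) ν = 0

/-- Wall boundary conditions: `∇φ · n = M(φ)∇(μ+αp) · n = 0` on `∂Ω`, no slip `v = 0` on `Γ₁`,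
and free slip on `Γ₂`, i.e. `v · n = 0` and zero tangential part of the traction `S n`. -/
structure WallConditions (P : Data d) (T : ℝ) (Ω Γ₁ Γ₂ : Set (Vec d))
    (φ : ℝ → Vec d → ℝ) (v : ℝ → Vec d → Vec d) (μ p : ℝ → Vec d → ℝ) : Prop where
  cover : Γ₁ ∪ Γ₂ = frontier Ω
  phase : ∀ t ∈ Ioo 0 T, ∀ x ν, IsOutwardNormal Ω x ν → inner ℝ (gradient (φ t) x) ν = 0
  flux : ∀ t ∈ Ioo 0 T, ∀ x ν, IsOutwardNormal Ω x ν →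
    inner ℝ (P.flux (φ t) (P.pot (μ t) (p t)) x) ν = 0
  velocity : ∀ t ∈ Ioo 0 T, NoPenetration Ω Γ₁ Γ₂ (v t)
  free_slip : ∀ t ∈ Ioo 0 T, ∀ x ∈ Γ₂, ∀ ν, IsOutwardNormal Ω x ν →
    ∀ τ : Vec d, inner ℝ τ ν = 0 → inner ℝ (P.stress (φ t) (v t) x ν) τ = 0

/-! ### Periodic setting -/

/-- The open hypercube `∏ₖ (aₖ, aₖ + L)`. -/
def cube (a : Vec d) (L : ℝ) : Set (Vec d) := {x | ∀ k, x k ∈ Ioo (a k) (a k + L)}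

/-- `L`-periodicity in every coordinate direction. -/
def IsPeriodic {F : Type} (L : ℝ) (u : Vec d → F) : Prop :=
  ∀ x, ∀ k : Fin d, u (x + L • stdVec k) = u x

/-! ### The variational formulation -/

/-- The variational formulation at time `t` on `Ω`, with scalar test functions in `V` and vector
test functions in `X`; the test functions of the last equation are mean-free. -/
structure WeakFormulation (P : Data d) (Ω : Set (Vec d)) (V : Set (Vec d → ℝ))
    (X : Set (Vec d → Vec d)) (φ : ℝ → Vec d → ℝ) (v : ℝ → Vec d → Vec d)
    (μ p : ℝ → Vec d → ℝ) (t : ℝ) : Prop where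
  phase : ∀ ψ ∈ V,
    pair Ω (fun x => deriv (fun s => φ s x) t) ψ
      - pair Ω (fun x => φ t x • v t x) (gradient ψ)
      + pair Ω (P.flux (φ t) (P.pot (μ t) (p t))) (gradient ψ) = 0
  chem : ∀ ξ ∈ V,
    pair Ω (μ t) ξ - P.γ * pair Ω (gradient (φ t)) (gradient ξ)
      - pair Ω (fun x => deriv P.f (φ t x)) ξ = 0
  mom : ∀ w ∈ X,
    pair Ω (fun x => (deriv (fun s => P.ρ (φ s x)) t / 2) • v t x
        + P.ρ (φ t x) • deriv (fun s => v s x) t) w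
      + cskw Ω (fun x => P.ρ (φ t x) • v t x) (v t) w
      + tpair Ω (P.stress (φ t) (v t)) (fderiv ℝ w)
      - pair Ω (p t) (vdiv w)
      + pair Ω (fun x => φ t x • gradient (μ t) x) w
      + pair Ω (fun x => P.ρ (φ t x) • (P.g • P.j)) w = 0
  div : ∀ q ∈ V, ∫ x in Ω, q x = 0 →
    pair Ω (vdiv (v t)) q
      + P.α * pair Ω (P.flux (φ t) (P.pot (μ t) (p t))) (gradient q) = 0

/-- Conservation of `⟨φ, 1⟩` at time `t`. -/
def MassConserved (Ω : Set (Vec d)) (φ : ℝ → Vec d → ℝ) (t : ℝ) : Prop :=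
  HasDerivAt (fun s => pair Ω (φ s) (fun _ => (1 : ℝ))) 0 t

/-- Conservation of `⟨ρ(φ), 1⟩` at time `t`. -/
def DensityConserved (P : Data d) (Ω : Set (Vec d)) (φ : ℝ → Vec d → ℝ) (t : ℝ) : Prop :=
  HasDerivAt (fun s => pair Ω (fun x => P.ρ (φ s x)) (fun _ => (1 : ℝ))) 0 t

/-- The energy law `d/dt E(φ, v) = - D_φ(μ + α p, v)` at time `t`. -/
def EnergyLaw (P : Data d) (Ω : Set (Vec d)) (φ : ℝ → Vec d → ℝ) (v : ℝ → Vec d → Vec d)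
    (μ p : ℝ → Vec d → ℝ) (t : ℝ) : Prop :=
  HasDerivAt (fun s => P.energy Ω (φ s) (v s))
    (-P.dissipation Ω (φ t) (P.pot (μ t) (p t)) (v t)) t

end NSCH

end

noncomputable section

namespace NSCH

variable {d : ℕ}

/-! All boundary conditions act through one fact: a C¹ field F that is tangential at every boundary
point with a normal, or periodic on a cell, satisfies ∫_Ω div F = 0. Each weak equation is the
tested strong equation up to divergences of such fields: ψφv, ψM∇(μ+αp), ξ∇φ, pw, (v·w)ρv and Sᵀw.
Hence `IsSmoothSolution.conclusions` works with an abstract class `N` of fields whose divergence has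
zero mean, and both settings only supply membership in `N`.

The energy law comes from ψ = μ, ξ = ∂ₜφ, w = v, q = p: the skew convection term vanishes, the
capillary force cancels the transport term ⟨φv,∇μ⟩, and the pressure terms cancel. Gravity is
balanced by testing the phase and divergence equations with y; the definition of α makes the
diffusive fluxes cancel there (`IsSmoothSolution.gravity_work`). Since ρ is affine, both
conservation laws follow from ψ = 1.

The analytic core is the divergence theorem for tangential fields on a Lipschitz domain, proved
without surface measure or traces. Locally Ω = {w > 0} with w Lipschitz. The indicator of Ω is
approximated by the ramps min(1, w/ε)⁺, and integration by parts leaves ε⁻¹∇w·G on the strip 0 < w <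
ε. Sliding a point of the strip onto the graph preserves ∇w, which is there a multiple of the
normal, so ∇w·G = O(ε). Thus the integrands are uniformly bounded, tend to 0 pointwise, and
dominated convergence applies. The periodic case is the divergence theorem on a box, whose opposite
faces cancel. -/

/-- The `k`-th coordinate functional. -/
abbrev coordL (k : Fin d) : Vec d →L[ℝ] ℝ := EuclideanSpace.proj k

/-! ### Divergence in coordinates and integration by parts against Lipschitz functions -/

lemma sum_coord_smul_stdVec (x : Vec d) : ∑ k, x k • stdVec k = x := by
  ext i
  simp [stdVec, Finset.sum_apply, Pi.single_apply]

lemma vdiv_eq_sum_fderiv_coord {F : Vec d → Vec d} {x : Vec d} (hF : DifferentiableAt ℝ F x) :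
    vdiv F x = ∑ k, fderiv ℝ (fun z => F z k) x (stdVec k) := by
  unfold vdiv
  refine Finset.sum_congr rfl fun k _ => ?_
  have h := ((coordL k).hasFDerivAt.comp x hF.hasFDerivAt).fderiv
  have h' : fderiv ℝ (fun z => F z k) x = _ := h
  rw [h']
  rfl

lemma contDiff_coord {n : ℕ∞} {F : Vec d → Vec d} (hF : ContDiff ℝ n F) (k : Fin d) :
    ContDiff ℝ n (fun z => F z k) :=
  (coordL k).contDiff.comp hF

lemma continuous_vdiv {F : Vec d → Vec d} (hF : ContDiff ℝ 1 F) : Continuous (vdiv F) := by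
  unfold vdiv
  refine continuous_finsetSum _ fun k _ => ?_
  exact (coordL k).continuous.comp
    ((hF.continuous_fderiv (by simp)).clm_apply continuous_const)

lemma integrableOn_of_isBounded {F : Type*} [NormedAddCommGroup F] {Ω : Set (Vec d)}
    (hΩ : Bornology.IsBounded Ω) {f : Vec d → F} (hf : Continuous f) : IntegrableOn f Ω :=
  (hf.continuousOn.integrableOn_compact hΩ.isCompact_closure).mono_set subset_closure

lemma hasCompactSupport_vdiv {F : Vec d → Vec d} (hF : HasCompactSupport F) :
    HasCompactSupport (vdiv F) := by
  refine (hF.fderiv ℝ).mono fun x hx => ?_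
  contrapose! hx
  simp only [Function.mem_support, not_not] at hx ⊢
  simp [vdiv, hx]

lemma measurable_fderiv_apply {θ : Vec d → ℝ} {G : Vec d → Vec d} (hG : Continuous G) :
    Measurable fun x => fderiv ℝ θ x (G x) := by
  have : (fun x => fderiv ℝ θ x (G x)) = fun x => ∑ k, G x k * fderiv ℝ θ x (stdVec k) := by
    funext x
    conv_lhs => rw [← sum_coord_smul_stdVec (G x)]
    simp
  rw [this]
  refine Finset.measurable_sum _ fun k _ => ?_
  exact ((coordL k).continuous.comp
    hG).measurable.mul (measurable_fderiv_apply_const ℝ θ _)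

/-- Integration by parts of a Lipschitz function against a compactly supported `C¹` field. -/
lemma integral_mul_vdiv {θ : Vec d → ℝ} {C : NNReal} (hθ : LipschitzWith C θ)
    {G : Vec d → Vec d} (hG : ContDiff ℝ 1 G) (hGc : HasCompactSupport G) :
    ∫ x, θ x * vdiv G x = -∫ x, fderiv ℝ θ x (G x) := by
  have hk : ∀ k : Fin d, ContDiff ℝ 1 (fun z => G z k) := contDiff_coord hG
  have hkc : ∀ k : Fin d, HasCompactSupport (fun z => G z k) := fun k =>
    hGc.comp_left (g := fun v : Vec d => v k) rfl
  have hparts : ∀ k : Fin d, ∫ x, lineDeriv ℝ θ x (stdVec k) * G x k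
      = -∫ x, θ x * fderiv ℝ (fun z => G z k) x (stdVec k) := by
    intro k
    obtain ⟨D, hD⟩ := (hk k).lipschitzWith_of_hasCompactSupport (hkc k) (by simp)
    rw [LipschitzWith.integral_lineDeriv_mul_eq hθ hD (hkc k), ← integral_neg]
    refine integral_congr_ae (Eventually.of_forall fun x => ?_)
    simp only [(((hk k).differentiable (by simp)) x).lineDeriv_eq_fderiv, map_neg]
    ring
  have hI1 : ∀ k : Fin d, Integrable fun x => lineDeriv ℝ θ x (stdVec k) * G x k := by
    intro k
    refine Integrable.bdd_mul (c := C * ‖(stdVec k : Vec d)‖)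
      ((hk k).continuous.integrable_of_hasCompactSupport (hkc k))
      (measurable_lineDeriv hθ.continuous).aestronglyMeasurable ?_
    exact Eventually.of_forall fun x => norm_lineDeriv_le_of_lipschitz ℝ hθ
  have hI2 : ∀ k : Fin d, Integrable fun x => θ x * fderiv ℝ (fun z => G z k) x (stdVec k) := by
    intro k
    refine Continuous.integrable_of_hasCompactSupport ?_ ?_
    · exact hθ.continuous.mul
        (((hk k).continuous_fderiv (by simp)).clm_apply continuous_const)
    · exact ((hkc k).fderiv_apply ℝ _).mul_left
  calc ∫ x, θ x * vdiv G x
      = ∫ x, ∑ k, θ x * fderiv ℝ (fun z => G z k) x (stdVec k) := by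
        refine integral_congr_ae (Eventually.of_forall fun x => ?_)
        simp only [vdiv_eq_sum_fderiv_coord (hG.differentiable (by simp) x), Finset.mul_sum]
    _ = ∑ k, ∫ x, θ x * fderiv ℝ (fun z => G z k) x (stdVec k) :=
        integral_finsetSum _ fun k _ => hI2 k
    _ = -∑ k, ∫ x, lineDeriv ℝ θ x (stdVec k) * G x k := by
        simp [hparts]
    _ = -∫ x, ∑ k, lineDeriv ℝ θ x (stdVec k) * G x k := by
        rw [integral_finsetSum _ fun k _ => hI1 k]
    _ = -∫ x, fderiv ℝ θ x (G x) := by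
        congr 1
        refine integral_congr_ae ?_
        -- Rademacher: line derivatives and the Fréchet derivative agree almost everywhere.
        filter_upwards [hθ.ae_differentiableAt] with x hx
        conv_rhs => rw [← sum_coord_smul_stdVec (G x)]
        simp [hx.lineDeriv_eq_fderiv, mul_comm]

lemma integral_vdiv_eq_zero {G : Vec d → Vec d} (hG : ContDiff ℝ 1 G)
    (hGc : HasCompactSupport G) : ∫ x, vdiv G x = 0 := by
  have := integral_mul_vdiv (LipschitzWith.const (1 : ℝ)) hG hGc
  simpa using this

/-! ### Outward normals and the divergence theorem on Lipschitz domains -/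

/-- At a boundary point where the local graph function is differentiable, the normalised negative
gradient of the defining function is an outward normal. -/
lemma isOutwardNormal_of_hasGradientAt {Ω : Set (Vec d)} (hΩ : IsOpen Ω) {w : Vec d → ℝ}
    {x n : Vec d} (hx : w x = 0) (hloc : ∀ᶠ z in 𝓝 x, (z ∈ Ω ↔ 0 < w z))
    (hw : HasGradientAt w n x) (hn : n ≠ 0) : IsOutwardNormal Ω x (-(‖n‖⁻¹ • n)) := by
  have hn0 : 0 < ‖n‖ := norm_pos_iff.mpr hn
  have key : ∀ ε > 0, ∀ᶠ z in 𝓝 x,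
      (inner ℝ (-(‖n‖⁻¹ • n)) (z - x) < -ε * ‖z - x‖ → z ∈ Ω) ∧
      (ε * ‖z - x‖ < inner ℝ (-(‖n‖⁻¹ • n)) (z - x) → z ∉ Ω) := by
    intro ε hε
    have h1 := (hasGradientAt_iff_isLittleO.mp hw).def (c := ε * ‖n‖) (by positivity)
    filter_upwards [hloc, h1] with z hz h1
    rw [hx, sub_zero, Real.norm_eq_abs, abs_le] at h1
    have e1 : inner ℝ (-(‖n‖⁻¹ • n)) (z - x) = -(‖n‖⁻¹ * inner ℝ n (z - x)) := by
      rw [inner_neg_left, real_inner_smul_left]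
    have e2 : inner ℝ n (z - x) = ‖n‖ * (‖n‖⁻¹ * inner ℝ n (z - x)) := by
      field_simp
    rw [e1, hz]
    set q := ‖n‖⁻¹ * inner ℝ n (z - x)
    rw [e2] at h1
    constructor
    · intro hq
      have : ‖n‖ * (ε * ‖z - x‖) < ‖n‖ * q := by
        apply mul_lt_mul_of_pos_left _ hn0
        linarith
      nlinarith [h1.1]
    · intro hq
      have : ‖n‖ * q < ‖n‖ * (-(ε * ‖z - x‖)) := by
        apply mul_lt_mul_of_pos_left _ hn0
        linarith
      nlinarith [h1.2]
  refine ⟨?_, ?_, key⟩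
  · rw [hΩ.frontier_eq]
    refine ⟨?_, fun hxΩ => ?_⟩
    -- The points x + s n with small s > 0 satisfy the inner half-space condition of `key`, so they
    -- lie in Ω and accumulate at x.
    · rw [mem_closure_iff_frequently]
      have hlim : Tendsto (fun s : ℝ => x + s • n) (𝓝[>] 0) (𝓝 x) := by
        have : Tendsto (fun s : ℝ => x + s • n) (𝓝 0) (𝓝 (x + (0 : ℝ) • n)) := by
          apply Continuous.tendsto; fun_prop
        rw [zero_smul, add_zero] at this
        exact this.mono_left nhdsWithin_le_nhds
      refine hlim.frequently (Eventually.frequently ?_)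
      filter_upwards [hlim.eventually (key (1 / 2) (by norm_num)), self_mem_nhdsWithin] with s hs hs0
      refine hs.1 ?_
      rw [mem_Ioi] at hs0
      rw [add_sub_cancel_left, inner_neg_left, real_inner_smul_left, real_inner_smul_right,
        real_inner_self_eq_norm_sq, norm_smul, Real.norm_of_nonneg hs0.le]
      have : ‖n‖⁻¹ * (s * ‖n‖ ^ 2) = s * ‖n‖ := by field_simp
      rw [this]
      have : 0 < s * ‖n‖ := by positivity
      linarith
    · exact absurd (hloc.self_of_nhds.mp hxΩ) (by simp [hx])
  · rw [norm_neg, norm_smul, norm_inv, norm_norm, inv_mul_cancel₀ hn0.ne']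

/-- Cut-off of a defining function `w` at height `ε`. -/
def ramp (ε : ℝ) (w : Vec d → ℝ) (z : Vec d) : ℝ := max 0 (min 1 (ε⁻¹ * w z))

lemma ramp_nonneg (ε : ℝ) (w : Vec d → ℝ) (z : Vec d) : 0 ≤ ramp ε w z := le_max_left _ _

lemma ramp_le_one (ε : ℝ) (w : Vec d → ℝ) (z : Vec d) : ramp ε w z ≤ 1 := by
  simp [ramp]

lemma lipschitzWith_ramp {ε : ℝ} {w : Vec d → ℝ} {C : NNReal} (hw : LipschitzWith C w) :
    ∃ D, LipschitzWith D (ramp ε w) := by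
  have h1 : LipschitzWith (‖ε⁻¹‖₊ * C) (fun z => ε⁻¹ * w z) := by
    simpa [Function.comp_def] using (lipschitzWith_smul (β := ℝ) ε⁻¹).comp hw
  exact ⟨_, (h1.const_min 1).const_max 0⟩

lemma ramp_of_nonpos {ε : ℝ} (hε : 0 < ε) {w : Vec d → ℝ} {z : Vec d} (h : w z ≤ 0) :
    ramp ε w z = 0 := by
  have : ε⁻¹ * w z ≤ 0 := mul_nonpos_of_nonneg_of_nonpos (by positivity) h
  unfold ramp
  rw [max_eq_left]
  exact (min_le_right _ _).trans this

lemma ramp_of_ge {ε : ℝ} (hε : 0 < ε) {w : Vec d → ℝ} {z : Vec d} (h : ε ≤ w z) :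
    ramp ε w z = 1 := by
  have : 1 ≤ ε⁻¹ * w z := by
    rw [inv_mul_eq_div, le_div_iff₀ hε]; simpa using h
  simp [ramp, this]

/-- The ramp attains its minimum 0 or its maximum 1 at such points. The kinks are included: where
the ramp is not differentiable, `fderiv` takes its default value 0. -/
lemma fderiv_ramp_eq_zero {ε : ℝ} (hε : 0 < ε) {w : Vec d → ℝ} {z : Vec d}
    (h : w z ≤ 0 ∨ ε ≤ w z) : fderiv ℝ (ramp ε w) z = 0 := by
  rcases h with h | h
  · refine IsLocalMin.fderiv_eq_zero (Eventually.of_forall fun y => ?_)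
    rw [ramp_of_nonpos hε h]; exact ramp_nonneg _ _ _
  · refine IsLocalMax.fderiv_eq_zero (Eventually.of_forall fun y => ?_)
    rw [ramp_of_ge hε h]; exact ramp_le_one _ _ _

lemma fderiv_ramp {ε : ℝ} (hε : 0 < ε) {w : Vec d → ℝ} (hc : Continuous w) {z : Vec d}
    (h0 : 0 < w z) (h1 : w z < ε) :
    fderiv ℝ (ramp ε w) z = ε⁻¹ • fderiv ℝ w z := by
  have : ramp ε w =ᶠ[𝓝 z] fun y => ε⁻¹ • w y := by
    filter_upwards [hc.continuousAt.eventually (Ioo_mem_nhds h0 h1)] with y hy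
    have h2 : 0 ≤ ε⁻¹ * w y := by have := hy.1; positivity
    have h3 : ε⁻¹ * w y ≤ 1 := by
      rw [inv_mul_eq_div, div_le_iff₀ hε]; simpa using hy.2.le
    simp [ramp, h2, h3]
  rw [this.fderiv_eq]
  have h := congrFun (fderiv_const_smul_field (𝕜 := ℝ) (R := ℝ) (f := w) ε⁻¹) z
  exact h

lemma tendsto_ramp {w : Vec d → ℝ} {ε : ℕ → ℝ} (hε : ∀ n, 0 < ε n)
    (hlim : Tendsto ε atTop (𝓝 0)) (z : Vec d) :
    Tendsto (fun n => ramp (ε n) w z) atTop (𝓝 (if 0 < w z then 1 else 0)) := by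
  split_ifs with h
  · refine tendsto_const_nhds.congr' ?_
    filter_upwards [hlim.eventually (gt_mem_nhds h)] with n hn
    rw [ramp_of_ge (hε n) hn.le]
  · refine tendsto_const_nhds.congr' (Eventually.of_forall fun n => ?_)
    exact (ramp_of_nonpos (hε n) (not_lt.mp h)).symm

/-- Although the gradients have size ε⁻¹, the strip 0 < w < ε carrying them eventually misses each
fixed point. -/
lemma tendsto_fderiv_ramp {w : Vec d → ℝ} {ε : ℕ → ℝ} (hε : ∀ n, 0 < ε n)
    (hlim : Tendsto ε atTop (𝓝 0)) (z u : Vec d) :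
    Tendsto (fun n => fderiv ℝ (ramp (ε n) w) z u) atTop (𝓝 0) := by
  refine tendsto_const_nhds.congr' ?_
  by_cases h : 0 < w z
  · filter_upwards [hlim.eventually (gt_mem_nhds h)] with n hn
    rw [fderiv_ramp_eq_zero (hε n) (Or.inr hn.le)]; rfl
  · refine Eventually.of_forall fun n => ?_
    simp only [fderiv_ramp_eq_zero (hε n) (Or.inl (not_lt.mp h))]; rfl

lemma inner_gradient_left {u : Vec d → ℝ} {x y : Vec d} :
    inner ℝ (gradient u x) y = fderiv ℝ u x y := by
  simp [gradient]

/-- Divergence theorem for a tangential field supported near a boundary point. -/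
lemma setIntegral_vdiv_eq_zero_of_graph {Ω : Set (Vec d)} (hΩ : IsOpen Ω) {x₀ e : Vec d}
    (he : ‖e‖ = 1) {K : NNReal} {h : Vec d → ℝ} (hh : LipschitzWith K h)
    (hinv : ∀ z, ∀ s : ℝ, h (z + s • e) = h z) {r : ℝ} (hr : 0 < r)
    (hloc : ∀ z ∈ Metric.ball x₀ (2 * r), (z ∈ Ω ↔ inner ℝ e z < h z))
    {G : Vec d → Vec d} (hG : ContDiff ℝ 1 G) (hGs : tsupport G ⊆ Metric.ball x₀ r)
    (hGn : ∀ x ν, IsOutwardNormal Ω x ν → inner ℝ (G x) ν = 0) :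
    ∫ x in Ω, vdiv G x = 0 := by
  have hGc : HasCompactSupport G :=
    (isCompact_closedBall x₀ r).of_isClosed_subset (isClosed_tsupport G)
      (hGs.trans Metric.ball_subset_closedBall)
  -- The height below the graph in direction e: a shift by s e lowers it by exactly s (`hws`).
  set w : Vec d → ℝ := fun z => h z - inner ℝ e z with hwdef
  have hwl : LipschitzWith (K + ‖innerSL ℝ e‖₊) w := hh.sub (innerSL ℝ e).lipschitz
  have hee : inner ℝ e e = 1 := by rw [real_inner_self_eq_norm_sq, he]; norm_num
  have hws : ∀ z, ∀ s : ℝ, w (z + s • e) = w z - s := by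
    intro z s
    simp only [hwdef, hinv, inner_add_right, real_inner_smul_right, hee]
    ring
  have hpos : ∀ z ∈ Metric.ball x₀ (2 * r), (z ∈ Ω ↔ 0 < w z) := by
    intro z hz
    rw [hloc z hz, hwdef]
    exact sub_pos.symm
  obtain ⟨D, hD⟩ := hG.lipschitzWith_of_hasCompactSupport hGc (by simp)
  set C : NNReal := K + ‖innerSL ℝ e‖₊
  have hG0 : ∀ z, z ∉ Metric.ball x₀ r → G z = 0 := fun z hz =>
    image_eq_zero_of_notMem_tsupport fun hz' => hz (hGs hz')
  -- The dominating function must not depend on ε: the factor ε⁻¹ of the ramp is paid for by the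
  -- variation of G over a distance at most ε.
  have hbound : ∀ ε, 0 < ε → ε < r → ∀ᵐ z : Vec d,
      ‖fderiv ℝ (ramp ε w) z (G z)‖ ≤ (Metric.ball x₀ r).indicator (fun _ => (C * D : ℝ)) z := by
    intro ε hε hεr
    filter_upwards [hwl.ae_differentiableAt] with z hz
    by_cases hzb : z ∈ Metric.ball x₀ r
    swap
    · rw [hG0 z hzb, map_zero, norm_zero]
      exact indicator_nonneg (fun _ _ => by positivity) _
    rw [indicator_of_mem hzb]
    by_cases hzw : w z ≤ 0 ∨ ε ≤ w z
    · rw [fderiv_ramp_eq_zero hε hzw]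
      simp only [zero_apply, norm_zero]
      positivity
    push Not at hzw
    rw [fderiv_ramp hε hwl.continuous hzw.1 hzw.2]
    -- The graph point above z. Since w z < ε < r, it stays in the larger ball, where Ω is described
    -- by w.
    set x : Vec d := z + w z • e with hxdef
    have hxz : ‖x - z‖ = w z := by
      rw [hxdef, add_sub_cancel_left, norm_smul, he, mul_one, Real.norm_of_nonneg hzw.1.le]
    have hxb : x ∈ Metric.ball x₀ (2 * r) := by
      rw [Metric.mem_ball] at hzb ⊢
      have : dist x z < r := by rw [dist_eq_norm, hxz]; linarith [hzw.2]
      linarith [dist_triangle x z x₀]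
    have hwx : w x = 0 := by rw [hxdef, hws, sub_self]
    -- Up to a constant, w is invariant under shifts along e, so differentiability and the gradient
    -- pass from z to x. Rademacher's theorem in the full space thus provides the normals that are
    -- needed.
    have hgrad : HasGradientAt w (gradient w z) x := by
      have h1 : HasFDerivAt w (fderiv ℝ w z) (x - w z • e) := by
        rw [hxdef, add_sub_cancel_right]; exact hz.hasFDerivAt
      have h2 : HasFDerivAt (fun y => w (y - w z • e) - w z) (fderiv ℝ w z) x := by
        have := (h1.comp x ((hasFDerivAt_id x).sub_const (w z • e))).sub_const (w z)
        simpa [Function.comp_def] using this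
      rw [hasGradientAt_iff_hasFDerivAt, toDual_gradient]
      refine h2.congr_of_eventuallyEq (Eventually.of_forall fun y => ?_)
      have := hws (y - w z • e) (w z)
      rw [sub_add_cancel] at this
      exact this
    -- The derivative of w along e is -1.
    have hne : gradient w z ≠ 0 := by
      intro h0
      have h1 : HasDerivAt (fun s : ℝ => w (x + s • e)) (inner ℝ (gradient w z) e) 0 := by
        have h3 : HasFDerivAt w (fderiv ℝ w z) (x + (0 : ℝ) • e) := by
          rw [zero_smul, add_zero]
          have := hgrad.hasFDerivAt
          rwa [toDual_gradient] at this
        have h4 : HasDerivAt (fun s : ℝ => x + s • e) e 0 := by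
          simpa using ((hasDerivAt_id (0 : ℝ)).smul_const e).const_add x
        rw [inner_gradient_left]
        exact h3.comp_hasDerivAt (0 : ℝ) h4
      have h2 : HasDerivAt (fun s : ℝ => w (x + s • e)) (-1) 0 := by
        simp only [hws]
        exact (hasDerivAt_id (0 : ℝ)).const_sub (w x)
      have := h1.unique h2
      rw [h0, inner_zero_left] at this
      norm_num at this
    have hGx : fderiv ℝ w z (G x) = 0 := by
      have hnrm := hGn x _ (isOutwardNormal_of_hasGradientAt hΩ hwx
        (eventually_of_mem (Metric.isOpen_ball.mem_nhds hxb) hpos) hgrad hne)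
      rw [inner_neg_right, real_inner_smul_right, neg_eq_zero, mul_eq_zero, inv_eq_zero,
        norm_eq_zero, or_iff_right hne, real_inner_comm, inner_gradient_left] at hnrm
      exact hnrm
    have h1 : fderiv ℝ w z (G z) = fderiv ℝ w z (G z - G x) := by rw [map_sub, hGx, sub_zero]
    have h2 : ‖fderiv ℝ w z‖ ≤ C := norm_fderiv_le_of_lipschitz ℝ hwl
    have h3 : ‖G z - G x‖ ≤ D * ε := by
      refine (hD.norm_sub_le z x).trans ?_
      rw [norm_sub_rev, hxz]
      exact mul_le_mul_of_nonneg_left hzw.2.le D.2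
    calc ‖(ε⁻¹ • fderiv ℝ w z) (G z)‖ = ε⁻¹ * ‖fderiv ℝ w z (G z - G x)‖ := by
          rw [smul_apply, norm_smul, h1, norm_inv, Real.norm_of_nonneg hε.le]
      _ ≤ ε⁻¹ * (C * (D * ε)) := by
          gcongr
          exact (ContinuousLinearMap.le_opNorm _ _).trans (mul_le_mul h2 h3 (norm_nonneg _) C.2)
      _ = C * D := by field_simp
  -- The shift by 2 makes ε n < r strict already at n = 0.
  set ε : ℕ → ℝ := fun n => r / (n + 2) with hεdef
  have hε : ∀ n, 0 < ε n := fun n => by simp only [hεdef]; positivity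
  have hεr : ∀ n, ε n < r := fun n => by
    simp only [hεdef]
    have : (0 : ℝ) ≤ n := n.cast_nonneg
    rw [div_lt_iff₀ (by positivity)]
    nlinarith
  have hεlim : Tendsto ε atTop (𝓝 0) :=
    tendsto_const_nhds.div_atTop
      (tendsto_atTop_add_const_right _ _ tendsto_natCast_atTop_atTop)
  have hint : Integrable (vdiv G) :=
    (continuous_vdiv hG).integrable_of_hasCompactSupport (hasCompactSupport_vdiv hGc)
  have hL : Tendsto (fun n => ∫ x, ramp (ε n) w x * vdiv G x) atTop
      (𝓝 (∫ x in Ω, vdiv G x)) := by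
    rw [← integral_indicator hΩ.measurableSet]
    refine tendsto_integral_of_dominated_convergence (fun x => ‖vdiv G x‖) (fun n => ?_)
      hint.norm (fun n => Eventually.of_forall fun x => ?_) (Eventually.of_forall fun x => ?_)
    · obtain ⟨E, hE⟩ := lipschitzWith_ramp (ε := ε n) hwl
      exact (hE.continuous.mul (continuous_vdiv hG)).aestronglyMeasurable
    · rw [norm_mul, Real.norm_of_nonneg (ramp_nonneg _ _ _)]
      exact mul_le_of_le_one_left (norm_nonneg _) (ramp_le_one _ _ _)
    · by_cases hx : x ∈ Metric.ball x₀ (2 * r)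
      · have := (tendsto_ramp hε hεlim (w := w) x).mul_const (vdiv G x)
        by_cases hxΩ : x ∈ Ω
        · simpa [hxΩ, (hpos x hx).mp hxΩ] using this
        · simpa [hxΩ, mt (hpos x hx).mpr hxΩ] using this
      -- Outside the larger ball w says nothing about Ω, but G vanishes near such points.
      · have h0 : vdiv G x = 0 := by
          refine image_eq_zero_of_notMem_tsupport fun hx' => hx ?_
          have h1 : tsupport (vdiv G) ⊆ tsupport G := by
            refine closure_minimal (fun y hy => ?_) (isClosed_tsupport G)
            by_contra hy'
            apply hy
            have : fderiv ℝ G y = 0 := image_eq_zero_of_notMem_tsupport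
              fun hy'' => hy' (tsupport_fderiv_subset ℝ hy'')
            simp [vdiv, this]
          exact Metric.ball_subset_ball (by linarith) (hGs (h1 hx'))
        have h1 : Ω.indicator (vdiv G) x = 0 := by
          by_cases hxΩ : x ∈ Ω <;> simp [hxΩ, h0]
        simp only [h0, mul_zero, h1, tendsto_const_nhds]
  have hR : Tendsto (fun n => ∫ x, fderiv ℝ (ramp (ε n) w) x (G x)) atTop (𝓝 0) := by
    have := tendsto_integral_of_dominated_convergence
      (F := fun n x => fderiv ℝ (ramp (ε n) w) x (G x)) (f := fun _ => (0 : ℝ)) (μ := volume)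
      ((Metric.ball x₀ r).indicator (fun _ => (C * D : ℝ)))
      (fun n => (measurable_fderiv_apply hG.continuous).aestronglyMeasurable)
      ((integrable_indicator_iff Metric.isOpen_ball.measurableSet).mpr
        (integrableOn_const Metric.isBounded_ball.measure_lt_top.ne))
      (fun n => hbound (ε n) (hε n) (hεr n))
      (Eventually.of_forall fun x => tendsto_fderiv_ramp hε hεlim x (G x))
    simpa using this
  refine tendsto_nhds_unique hL ?_
  have hE : ∀ n, ∫ x, ramp (ε n) w x * vdiv G x = -∫ x, fderiv ℝ (ramp (ε n) w) x (G x) := by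
    intro n
    obtain ⟨E, hE⟩ := lipschitzWith_ramp (ε := ε n) hwl
    exact integral_mul_vdiv hE hG hGc
  simp only [hE]
  simpa using hR.neg

lemma vdiv_sum {ι : Type*} (s : Finset ι) {F : ι → Vec d → Vec d}
    (hF : ∀ i ∈ s, ContDiff ℝ 1 (F i)) (x : Vec d) :
    vdiv (fun z => ∑ i ∈ s, F i z) x = ∑ i ∈ s, vdiv (F i) x := by
  unfold vdiv
  rw [fderiv_fun_sum fun i hi => (hF i hi).differentiable (by simp) x, Finset.sum_comm]
  simp

/-- Divergence theorem for tangential `C¹` fields on a bounded Lipschitz domain. -/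
theorem setIntegral_vdiv_eq_zero_of_tangential {Ω : Set (Vec d)}
    (hΩ : IsBoundedLipschitzDomain Ω) {F : Vec d → Vec d} (hF : ContDiff ℝ 1 F)
    (hFn : ∀ x ν, IsOutwardNormal Ω x ν → inner ℝ (F x) ν = 0) :
    ∫ x in Ω, vdiv F x = 0 := by
  have hlocal : ∀ x ∈ closure Ω, ∃ U : Set (Vec d), IsOpen U ∧ x ∈ U ∧
      ∀ χ : Vec d → ℝ, ContDiff ℝ 1 χ → tsupport χ ⊆ U →
        ∫ z in Ω, vdiv (fun y => χ y • F y) z = 0 := by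
    intro x hx
    by_cases hxΩ : x ∈ Ω
    · refine ⟨Ω, hΩ.isOpen, hxΩ, fun χ hχ hs => ?_⟩
      have hts : tsupport (fun y => χ y • F y) ⊆ Ω := (tsupport_smul_subset_left χ F).trans hs
      have hc : HasCompactSupport (fun y => χ y • F y) :=
        hΩ.isBounded.isCompact_closure.of_isClosed_subset (isClosed_tsupport _)
          (hts.trans subset_closure)
      rw [setIntegral_eq_integral_of_forall_compl_eq_zero fun z hz => ?_]
      · exact integral_vdiv_eq_zero (hχ.smul hF) hc
      · have : fderiv ℝ (fun y => χ y • F y) z = 0 := image_eq_zero_of_notMem_tsupport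
          fun hz' => hz (hts (tsupport_fderiv_subset ℝ hz'))
        simp [vdiv, this]
    · have hxf : x ∈ frontier Ω := by rw [hΩ.isOpen.frontier_eq]; exact ⟨hx, hxΩ⟩
      obtain ⟨e, he, K, h, hh, hinv, hloc⟩ := hΩ.locally_subgraph x hxf
      obtain ⟨R, hR, hball⟩ := Metric.eventually_nhds_iff_ball.mp hloc
      -- Half the radius: the graph lemma needs the subgraph description on a ball twice as large as
      -- the one containing the support.
      refine ⟨Metric.ball x (R / 2), Metric.isOpen_ball, Metric.mem_ball_self (by positivity),
        fun χ hχ hs => ?_⟩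
      refine setIntegral_vdiv_eq_zero_of_graph hΩ.isOpen he hh hinv (half_pos hR)
        (by simpa [mul_div_cancel₀] using hball) (hχ.smul hF)
        ((tsupport_smul_subset_left χ F).trans hs) fun y ν hν => ?_
      rw [real_inner_smul_left, hFn y ν hν, mul_zero]
  choose! U hUo hxU hU using hlocal
  obtain ⟨t, htΩ, ht⟩ := hΩ.isBounded.isCompact_closure.elim_nhds_subcover U
    fun x hx => (hUo x hx).mem_nhds (hxU x hx)
  obtain ⟨f, hf⟩ := SmoothPartitionOfUnity.exists_isSubordinate (ι := t)
    (modelWithCornersSelf ℝ (Vec d)) isClosed_closure (fun i => U i) (fun i => hUo i (htΩ i i.2))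
    (by simpa [iUnion_subtype] using ht)
  have hfs : ∀ i, ContDiff ℝ 1 (f i) := fun i =>
    ((f i).contMDiff.contDiff).of_le (by exact_mod_cast le_top)
  have hsum : ∀ x ∈ closure Ω, ∑ i, f i x = 1 := fun x hx => by
    rw [← finsum_eq_sum_of_fintype]; exact f.sum_eq_one hx
  have hFi : ∀ i ∈ (Finset.univ : Finset t), ContDiff ℝ 1 (fun z => f i z • F z) :=
    fun i _ => (hfs i).smul hF
  have hint : ∀ i ∈ (Finset.univ : Finset t), IntegrableOn (vdiv fun z => f i z • F z) Ω :=
    fun i hi => integrableOn_of_isBounded hΩ.isBounded (continuous_vdiv (hFi i hi))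
  have hcongr : ∀ x ∈ Ω, vdiv F x = ∑ i, vdiv (fun z => f i z • F z) x := by
    intro x hx
    rw [← vdiv_sum _ hFi]
    -- The partition sums to 1 only on the closure; openness of Ω turns this into an identity near
    -- x, which can be differentiated.
    have : F =ᶠ[𝓝 x] fun z => ∑ i, f i z • F z := by
      filter_upwards [hΩ.isOpen.mem_nhds hx] with z hz
      rw [← Finset.sum_smul, hsum z (subset_closure hz), one_smul]
    unfold vdiv
    rw [this.fderiv_eq]
  rw [setIntegral_congr_fun hΩ.isOpen.measurableSet hcongr, integral_finsetSum _ hint]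
  exact Finset.sum_eq_zero fun i _ => hU i (htΩ i i.2) (f i) (hfs i) (hf i)

/-! ### The divergence theorem on a period cell -/

lemma cube_eq_preimage (a : Vec d) (L : ℝ) :
    cube a L = WithLp.ofLp ⁻¹' (Set.pi univ fun k => Ioo (a k) (a k + L)) := by
  ext x; simp [cube]

lemma isOpen_cube (a : Vec d) (L : ℝ) : IsOpen (cube a L) := by
  rw [cube_eq_preimage]
  exact (isOpen_set_pi finite_univ fun _ _ => isOpen_Ioo).preimage (by fun_prop)

lemma isBounded_cube (a : Vec d) (L : ℝ) : Bornology.IsBounded (cube a L) := by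
  rw [cube_eq_preimage]
  have : WithLp.ofLp ⁻¹' (Set.pi univ fun k => Icc (a k) (a k + L))
      = (EuclideanSpace.equiv (Fin d) ℝ).symm '' (Set.pi univ fun k => Icc (a k) (a k + L)) := by
    rw [ContinuousLinearEquiv.image_symm_eq_preimage]; rfl
  refine Bornology.IsBounded.subset
    (IsCompact.isBounded (s := WithLp.ofLp ⁻¹' (Set.pi univ fun k => Icc (a k) (a k + L))) ?_)
    (preimage_mono (pi_mono fun _ _ => Ioo_subset_Icc_self))
  rw [this]
  exact (isCompact_univ_pi fun _ => isCompact_Icc).image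
    (EuclideanSpace.equiv (Fin d) ℝ).symm.continuous

/-- Divergence theorem for periodic `C¹` fields on a period cell. -/
theorem setIntegral_vdiv_eq_zero_of_isPeriodic (hd : 0 < d) (a : Vec d) {L : ℝ} (hL : 0 < L)
    {F : Vec d → Vec d} (hF : ContDiff ℝ 1 F) (hper : IsPeriodic L F) :
    ∫ x in cube a L, vdiv F x = 0 := by
  obtain ⟨n, rfl⟩ : ∃ n, d = n + 1 := ⟨d - 1, by omega⟩
  set E := EuclideanSpace.equiv (Fin (n + 1)) ℝ with hE
  have hmp : MeasurePreserving E volume volume := PiLp.volume_preserving_ofLp (Fin (n + 1))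
  have hcube : cube a L = E ⁻¹' (Set.pi univ fun k => Ioo (a k) (a k + L)) := cube_eq_preimage a L
  have h1 : ∫ x in cube a L, vdiv F x
      = ∫ y in Set.pi univ fun k => Ioo (E a k) (E a k + L), vdiv F (E.symm y) := by
    have := hmp.setIntegral_preimage_emb E.toHomeomorph.measurableEmbedding
      (fun y => vdiv F (E.symm y)) (Set.pi univ fun k => Ioo (a k) (a k + L))
    simp only [ContinuousLinearEquiv.symm_apply_apply] at this
    rw [hcube, this]
    rfl
  have hae : (Set.pi univ fun k => Ioo (E a k) (E a k + L))
      =ᵐ[(volume : Measure (Fin (n + 1) → ℝ))] Icc (E a) fun k => E a k + L := by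
    rw [volume_pi]; exact Measure.univ_pi_Ioo_ae_eq_Icc
  rw [h1, setIntegral_congr_set hae]
  have hsymm : ∀ i : Fin (n + 1), E.symm (Pi.single i 1) = stdVec i := fun i => rfl
  have hd : ∀ (i : Fin (n + 1)) y, HasFDerivAt (fun y => F (E.symm y) i)
      (((coordL i).comp (fderiv ℝ F (E.symm y))).comp (E.symm : (Fin (n + 1) → ℝ) →L[ℝ] Vec (n + 1))) y :=
    fun i y => ((coordL i).hasFDerivAt.comp _ (hF.differentiable (by simp) _).hasFDerivAt).comp y
      E.symm.hasFDerivAt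
  have key := integral_divergence_of_hasFDerivAt_off_countable' (E a) (fun k => E a k + L)
    (fun k => by simp [hL.le]) (fun i y => F (E.symm y) i)
    (fun i y => ((coordL i).comp (fderiv ℝ F (E.symm y))).comp
      (E.symm : (Fin (n + 1) → ℝ) →L[ℝ] Vec (n + 1))) ∅ countable_empty
    (fun i => (continuous_iff_continuousAt.mpr fun y => (hd i y).continuousAt).continuousOn)
    (fun y _ i => hd i y) (by
      refine Continuous.integrableOn_Icc (Continuous.comp (g := vdiv F) (continuous_vdiv hF)
        E.symm.continuous))
  refine Eq.trans key (Finset.sum_eq_zero fun i _ => ?_)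
  rw [sub_eq_zero]
  refine integral_congr_ae (Eventually.of_forall fun y => ?_)
  -- Opposite faces differ by one period, so their flux integrals agree.
  have : E.symm (i.insertNth (E a i + L) y) = E.symm (i.insertNth (E a i) y) + L • stdVec i := by
    rw [← hsymm, ← map_smul, ← map_add]
    congr 1
    ext j
    refine Fin.succAboveCases i ?_ (fun k => ?_) j
    · simp
    · simp
  simp only [this, hper _ i]

/-! ### Product rules and Green's formulas -/

lemma inner_stdVec_right (x : Vec d) (k : Fin d) : inner ℝ x (stdVec k) = x k := by
  simp [stdVec, EuclideanSpace.inner_single_right]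

lemma gradient_eq_sum (u : Vec d → ℝ) (x : Vec d) :
    gradient u x = ∑ k, fderiv ℝ u x (stdVec k) • stdVec k := by
  conv_lhs => rw [← sum_coord_smul_stdVec (gradient u x)]
  refine Finset.sum_congr rfl fun k _ => ?_
  rw [← inner_stdVec_right, inner_gradient_left]

lemma contDiff_gradient {m n : ℕ∞} {u : Vec d → ℝ} (hu : ContDiff ℝ n u) (hmn : m + 1 ≤ n) :
    ContDiff ℝ m (gradient u) := by
  have : gradient u = fun x => ∑ k, fderiv ℝ u x (stdVec k) • (stdVec k : Vec d) :=
    funext (gradient_eq_sum u)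
  rw [this]
  refine ContDiff.sum fun k _ => ContDiff.fun_smul ?_ contDiff_const
  exact (hu.fderiv_right (m := m) (by exact_mod_cast hmn)).clm_apply contDiff_const

lemma contDiff_vdiv {m n : ℕ∞} {F : Vec d → Vec d} (hF : ContDiff ℝ n F) (hmn : m + 1 ≤ n) :
    ContDiff ℝ m (vdiv F) := by
  unfold vdiv
  refine ContDiff.sum fun k _ => contDiff_coord ?_ k
  exact (hF.fderiv_right (m := m) (by exact_mod_cast hmn)).clm_apply contDiff_const

/-- The field `Aᵀ w`. -/
def transposeApply (A : Vec d → Vec d →L[ℝ] Vec d) (w : Vec d → Vec d) (x : Vec d) : Vec d :=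
  ∑ k, (inner ℝ (A x (stdVec k)) (w x) : ℝ) • stdVec k

lemma transposeApply_coord (A : Vec d → Vec d →L[ℝ] Vec d) (w : Vec d → Vec d) (x : Vec d)
    (k : Fin d) : transposeApply A w x k = inner ℝ (A x (stdVec k)) (w x) := by
  simp [transposeApply, stdVec, Pi.single_apply]

/-- For A = S the normal component of Sᵀw is the traction Sn tested with w, which is what the
no-slip and free-slip conditions annihilate. -/
lemma inner_transposeApply (A : Vec d → Vec d →L[ℝ] Vec d) (w : Vec d → Vec d) (x n : Vec d) :
    inner ℝ (transposeApply A w x) n = inner ℝ (A x n) (w x) := by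
  conv_rhs => rw [← sum_coord_smul_stdVec n]
  simp [transposeApply, sum_inner, real_inner_smul_left, real_inner_comm n,
    inner_stdVec_right, inner_sum, real_inner_smul_right, mul_comm]

lemma contDiff_transposeApply {A : Vec d → Vec d →L[ℝ] Vec d} {w : Vec d → Vec d}
    (hA : ∀ k, ContDiff ℝ 1 fun x => A x (stdVec k)) (hw : ContDiff ℝ 1 w) :
    ContDiff ℝ 1 (transposeApply A w) :=
  ContDiff.sum fun k _ => ((hA k).inner ℝ hw).smul contDiff_const

lemma vdiv_smul {u : Vec d → ℝ} {F : Vec d → Vec d} {x : Vec d} (hu : DifferentiableAt ℝ u x)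
    (hF : DifferentiableAt ℝ F x) :
    vdiv (fun z => u z • F z) x = u x * vdiv F x + inner ℝ (gradient u x) (F x) := by
  unfold vdiv
  rw [fderiv_fun_smul hu hF, inner_gradient_left, Finset.mul_sum]
  conv_rhs => rw [← sum_coord_smul_stdVec (F x)]
  simp only [map_sum, map_smul, ← Finset.sum_add_distrib]
  refine Finset.sum_congr rfl fun k _ => ?_
  simp
  ring

/-- Reduces integration by parts for tensors to the divergence of a single vector field. -/
lemma vdiv_transposeApply {A : Vec d → Vec d →L[ℝ] Vec d} {w : Vec d → Vec d}
    (hA : ∀ k, ContDiff ℝ 1 fun x => A x (stdVec k)) (hw : ContDiff ℝ 1 w) (x : Vec d) :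
    vdiv (transposeApply A w) x = inner ℝ (tdiv A x) (w x) + ddot (A x) (fderiv ℝ w x) := by
  rw [vdiv_eq_sum_fderiv_coord ((contDiff_transposeApply hA hw).differentiable (by simp) x), tdiv,
    ddot, sum_inner, ← Finset.sum_add_distrib]
  refine Finset.sum_congr rfl fun k _ => ?_
  simp only [transposeApply_coord]
  rw [fderiv_inner_apply ℝ ((hA k).differentiable (by simp) x) (hw.differentiable (by simp) x)]
  ring

section Pairing

variable {Ω : Set (Vec d)} {F : Type} [NormedAddCommGroup F] [InnerProductSpace ℝ F]

lemma pair_comm (a b : Vec d → F) : pair Ω a b = pair Ω b a := by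
  simp only [pair, real_inner_comm]

lemma pair_real (a b : Vec d → ℝ) : pair Ω a b = ∫ x in Ω, a x * b x := by
  simp [pair, mul_comm]

lemma pair_congr_left (hΩ : IsOpen Ω) {a a' : Vec d → F} (h : ∀ x ∈ Ω, a x = a' x)
    (b : Vec d → F) : pair Ω a b = pair Ω a' b :=
  setIntegral_congr_fun hΩ.measurableSet fun x hx => by simp only [h x hx]

lemma integrableOn_inner (hΩ : Bornology.IsBounded Ω) {a b : Vec d → F} (ha : Continuous a)
    (hb : Continuous b) : IntegrableOn (fun x => (inner ℝ (a x) (b x) : ℝ)) Ω :=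
  integrableOn_of_isBounded hΩ (ha.inner hb)

lemma pair_sub_left (hΩ : Bornology.IsBounded Ω) {a a' b : Vec d → F} (ha : Continuous a)
    (ha' : Continuous a') (hb : Continuous b) :
    pair Ω (fun x => a x - a' x) b = pair Ω a b - pair Ω a' b := by
  simp only [pair, inner_sub_left]
  exact integral_sub (integrableOn_inner hΩ ha hb) (integrableOn_inner hΩ ha' hb)

lemma pair_smul_left (c : ℝ) (a b : Vec d → F) :
    pair Ω (fun x => c • a x) b = c * pair Ω a b := by
  simp only [pair, real_inner_smul_left]
  exact integral_const_mul _ _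

/-- Green's formula without boundary term. -/
lemma pair_vdiv (hΩ : Bornology.IsBounded Ω) {u : Vec d → ℝ} {F : Vec d → Vec d}
    (hu : ContDiff ℝ 1 u) (hF : ContDiff ℝ 1 F)
    (h : ∫ x in Ω, vdiv (fun z => u z • F z) x = 0) :
    pair Ω (vdiv F) u = -pair Ω F (gradient u) := by
  have hg : Continuous (gradient u) := (contDiff_gradient (m := 0) hu (by simp)).continuous
  have h' : ∀ x, vdiv (fun z => u z • F z) x
      = inner ℝ (vdiv F x) (u x) + inner ℝ (F x) (gradient u x) := fun x => by
    rw [vdiv_smul (hu.differentiable (by simp) x) (hF.differentiable (by simp) x),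
      real_inner_comm (gradient u x)]
    simp
  simp only [h'] at h
  rw [integral_add (integrableOn_inner hΩ (continuous_vdiv hF) hu.continuous)
    (integrableOn_inner hΩ hF.continuous hg)] at h
  simp only [pair]
  linarith

end Pairing

/-! ### Space-time regularity -/

section SmoothField

variable {F : Type} [NormedAddCommGroup F] [NormedSpace ℝ F] {T t : ℝ} {u : ℝ → Vec d → F}

lemma isOpen_Ioo_prod_univ (T : ℝ) : IsOpen (Ioo 0 T ×ˢ (univ : Set (Vec d))) :=
  isOpen_Ioo.prod isOpen_univ

lemma SmoothField.contDiffAt (h : SmoothField T u) (ht : t ∈ Ioo 0 T) (x : Vec d) :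
    ContDiffAt ℝ ∞ (fun z : ℝ × Vec d => u z.1 z.2) (t, x) :=
  ContDiffOn.contDiffAt h ((isOpen_Ioo_prod_univ T).mem_nhds ⟨ht, mem_univ x⟩)

lemma SmoothField.slice (h : SmoothField T u) (ht : t ∈ Ioo 0 T) : ContDiff ℝ ∞ (u t) :=
  contDiff_iff_contDiffAt.mpr fun x =>
    (h.contDiffAt ht x).comp x (contDiffAt_const.prodMk contDiffAt_id)

lemma SmoothField.hasFDerivAt (h : SmoothField T u) (ht : t ∈ Ioo 0 T) (x : Vec d) :
    HasFDerivAt (fun z : ℝ × Vec d => u z.1 z.2)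
      (fderiv ℝ (fun z : ℝ × Vec d => u z.1 z.2) (t, x)) (t, x) :=
  ((h.contDiffAt ht x).differentiableAt (by simp)).hasFDerivAt

lemma SmoothField.hasDerivAt' (h : SmoothField T u) (ht : t ∈ Ioo 0 T) (x : Vec d) :
    HasDerivAt (fun s => u s x) (fderiv ℝ (fun z : ℝ × Vec d => u z.1 z.2) (t, x) (1, 0)) t :=
  HasFDerivAt.comp_hasDerivAt (f := fun s : ℝ => (s, x)) t (h.hasFDerivAt ht x)
    ((hasDerivAt_id t).prodMk (hasDerivAt_const t x))

lemma SmoothField.hasDerivAt (h : SmoothField T u) (ht : t ∈ Ioo 0 T) (x : Vec d) :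
    HasDerivAt (fun s => u s x) (deriv (fun s => u s x) t) t :=
  (h.hasDerivAt' ht x).differentiableAt.hasDerivAt

lemma SmoothField.fderiv_slice (h : SmoothField T u) (ht : t ∈ Ioo 0 T) (x e : Vec d) :
    fderiv ℝ (u t) x e = fderiv ℝ (fun z : ℝ × Vec d => u z.1 z.2) (t, x) (0, e) := by
  have := HasFDerivAt.comp (f := fun y : Vec d => (t, y)) x (h.hasFDerivAt ht x)
    ((hasFDerivAt_const t x).prodMk (hasFDerivAt_id x))
  have h' : fderiv ℝ (u t) x = _ := this.fderiv
  rw [h']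
  simp

lemma SmoothField.fderiv_apply (h : SmoothField T u) (a : ℝ × Vec d) :
    SmoothField T fun s x => fderiv ℝ (fun z : ℝ × Vec d => u z.1 z.2) (s, x) a :=
  (ContDiffOn.fderiv_of_isOpen h (isOpen_Ioo_prod_univ T) (m := ∞) (by simp)).clm_apply
    contDiffOn_const

lemma SmoothField.congr {w : ℝ → Vec d → F} (h : SmoothField T u)
    (hw : ∀ s ∈ Ioo 0 T, ∀ x, w s x = u s x) : SmoothField T w :=
  ContDiffOn.congr h fun z hz => hw z.1 hz.1 z.2

lemma SmoothField.dt (h : SmoothField T u) : SmoothField T fun s x => deriv (fun r => u r x) s :=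
  (h.fderiv_apply (1, 0)).congr fun _ hs x => (h.hasDerivAt' hs x).deriv

lemma SmoothField.dx (h : SmoothField T u) (e : Vec d) :
    SmoothField T fun s x => fderiv ℝ (u s) x e :=
  (h.fderiv_apply (0, e)).congr fun _ hs x => h.fderiv_slice hs x e

/-- Both sides are values of the space-time second derivative on (1, 0) and (0, e), in opposite
orders; it is symmetric. -/
lemma SmoothField.deriv_fderiv (h : SmoothField T u) (ht : t ∈ Ioo 0 T) (x e : Vec d) :
    deriv (fun s => fderiv ℝ (u s) x e) t = fderiv ℝ (fun y => deriv (fun s => u s y) t) x e := by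
  set U := fun z : ℝ × Vec d => u z.1 z.2 with hU
  have hsymm : IsSymmSndFDerivAt ℝ U (t, x) :=
    (h.contDiffAt ht x).isSymmSndFDerivAt
      (by simpa using (WithTop.coe_le_coe.mpr le_top : ((2 : ℕ∞) : WithTop ℕ∞) ≤ ∞))
  have hdd : DifferentiableAt ℝ (fderiv ℝ U) (t, x) :=
    ((h.contDiffAt ht x).fderiv_right (m := 1)
      (WithTop.coe_le_coe.mpr le_top : ((1 + 1 : ℕ∞) : WithTop ℕ∞) ≤ ∞)).differentiableAt (by simp)
  have hcl : ∀ a b : ℝ × Vec d,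
      fderiv ℝ (fun z : ℝ × Vec d => fderiv ℝ U (z.1, z.2) a) (t, x) b
        = fderiv ℝ (fderiv ℝ U) (t, x) b a := by
    intro a b
    rw [fderiv_clm_apply (𝕜 := ℝ) hdd (differentiableAt_const a)]
    simp
  have e1 : deriv (fun s => fderiv ℝ (u s) x e) t
      = fderiv ℝ (fderiv ℝ U) (t, x) (1, 0) (0, e) := by
    have : (fun s => fderiv ℝ (u s) x e) =ᶠ[𝓝 t] fun s => fderiv ℝ U (s, x) (0, e) := by
      filter_upwards [isOpen_Ioo.mem_nhds ht] with s hs using h.fderiv_slice hs x e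
    rw [this.deriv_eq, ((h.fderiv_apply (0, e)).hasDerivAt' ht x).deriv, hcl]
  have e2 : fderiv ℝ (fun y => deriv (fun s => u s y) t) x e
      = fderiv ℝ (fderiv ℝ U) (t, x) (0, e) (1, 0) := by
    have : (fun y => deriv (fun s => u s y) t) = fun y => fderiv ℝ U (t, y) (1, 0) :=
      funext fun y => (h.hasDerivAt' ht y).deriv
    rw [this, (h.fderiv_apply (1, 0)).fderiv_slice ht x e, hcl]
  rw [e1, e2, hsymm]

lemma SmoothField.gradient {u : ℝ → Vec d → ℝ} (h : SmoothField T u) :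
    SmoothField T fun s x => gradient (u s) x := by
  simp only [gradient_eq_sum]
  exact ContDiffOn.sum fun k _ => ContDiffOn.smul (h.dx (stdVec k)) contDiffOn_const

lemma SmoothField.hasDerivAt_gradient {u : ℝ → Vec d → ℝ} (h : SmoothField T u)
    (ht : t ∈ Ioo 0 T) (x : Vec d) :
    HasDerivAt (fun s => _root_.gradient (u s) x)
      (_root_.gradient (fun y => deriv (fun s => u s y) t) x) t := by
  simp only [gradient_eq_sum]
  refine HasDerivAt.fun_sum fun k _ => HasDerivAt.smul_const ?_ _
  rw [← h.deriv_fderiv ht]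
  exact (h.dx (stdVec k)).hasDerivAt ht x

end SmoothField

/-- Differentiation under the integral sign over a bounded set. -/
lemma hasDerivAt_setIntegral {Ω : Set (Vec d)} (hΩ : Bornology.IsBounded Ω) {T t : ℝ}
    (ht : t ∈ Ioo 0 T) {e e' : ℝ → Vec d → ℝ} (he : ∀ s ∈ Ioo 0 T, Continuous (e s))
    (hd : ∀ s ∈ Ioo 0 T, ∀ x, HasDerivAt (fun r => e r x) (e' s x) s)
    (he' : ContinuousOn (fun z : ℝ × Vec d => e' z.1 z.2) (Ioo 0 T ×ˢ univ)) :
    HasDerivAt (fun s => ∫ x in Ω, e s x) (∫ x in Ω, e' t x) t := by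
  -- On the compact set [a, b] × closure Ω the time derivative is bounded by a constant, which
  -- dominates because Ω has finite measure.
  obtain ⟨a, b, htab, hn, hab⟩ : ∃ a b, t ∈ Icc a b ∧ Icc a b ∈ 𝓝 t ∧ Icc a b ⊆ Ioo 0 T :=
    exists_Icc_mem_subset_of_mem_nhds (isOpen_Ioo.mem_nhds ht)
  have hK : IsCompact (Icc a b ×ˢ closure Ω) := isCompact_Icc.prod hΩ.isCompact_closure
  obtain ⟨C, hC⟩ := hK.exists_bound_of_continuousOn
    (he'.mono (prod_mono hab (subset_univ _)))
  have hcont : Continuous (e' t) := by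
    rw [← continuousOn_univ]
    exact he'.comp (f := fun x : Vec d => (t, x)) (by fun_prop) fun x _ => ⟨ht, mem_univ x⟩
  refine (hasDerivAt_integral_of_dominated_loc_of_deriv_le (bound := fun _ => C) hn ?_
    (integrableOn_of_isBounded hΩ (he t ht)) hcont.aestronglyMeasurable ?_
    (integrableOn_const hΩ.measure_lt_top.ne) ?_).2
  · filter_upwards [hn] with s hs using (he s (hab hs)).aestronglyMeasurable
  · have h0 : ∀ᵐ x ∂(volume.restrict Ω), x ∈ closure Ω :=
      ae_mono (Measure.restrict_mono subset_closure le_rfl)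
        (ae_restrict_mem isClosed_closure.measurableSet)
    filter_upwards [h0] with x hx s hs using hC (s, x) ⟨hs, hx⟩
  · exact Eventually.of_forall fun x s hs => hd s (hab hs) x

/-! ### Regularity of the constitutive fields -/

lemma Data.contDiff_ρ (P : Data d) {n : WithTop ℕ∞} : ContDiff ℝ n P.ρ := by
  unfold Data.ρ; fun_prop

lemma Data.contDiff_η (P : Data d) {n : WithTop ℕ∞} : ContDiff ℝ n P.η := by
  unfold Data.η; fun_prop

lemma Data.ρ_eq (P : Data d) (s : ℝ) : P.ρ s = (P.ρ₁ + P.ρ₂) / 2 + (P.ρ₁ - P.ρ₂) / 2 * s := by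
  unfold Data.ρ; ring

lemma Data.hasDerivAt_ρ (P : Data d) (s : ℝ) : HasDerivAt P.ρ ((P.ρ₁ - P.ρ₂) / 2) s := by
  rw [funext P.ρ_eq]
  simpa using ((hasDerivAt_id s).const_mul ((P.ρ₁ - P.ρ₂) / 2)).const_add ((P.ρ₁ + P.ρ₂) / 2)

/-- This relation between the coefficients of the affine density and α cancels the diffusive flux in
the gravity balance. -/
lemma Data.sum_mul_α (P : Data d) : (P.ρ₁ + P.ρ₂) / 2 * P.α = -((P.ρ₁ - P.ρ₂) / 2) := by
  have := P.density_pos.ne'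
  unfold Data.α
  field_simp
  ring

lemma Data.contDiff_flux (P : Data d) {φ χ : Vec d → ℝ} (hφ : ContDiff ℝ 1 φ)
    (hχ : ContDiff ℝ 2 χ) : ContDiff ℝ 1 (P.flux φ χ) :=
  (P.M_smooth.comp hφ).clm_apply (contDiff_gradient (m := 1) (n := 2) hχ (by norm_num))

lemma adjoint_apply_stdVec (A : Vec d →L[ℝ] Vec d) (k : Fin d) :
    ContinuousLinearMap.adjoint A (stdVec k) = ∑ i, A (stdVec i) k • stdVec i := by
  conv_lhs => rw [← sum_coord_smul_stdVec (ContinuousLinearMap.adjoint A (stdVec k))]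
  refine Finset.sum_congr rfl fun i _ => ?_
  rw [← inner_stdVec_right, ContinuousLinearMap.adjoint_inner_left, real_inner_comm,
    inner_stdVec_right]

/-- Columns suffice, because `tdiv` and `ddot` only see the values on the standard basis. -/
lemma Data.contDiff_stress (P : Data d) {φ : Vec d → ℝ} {v : Vec d → Vec d}
    (hφ : ContDiff ℝ 1 φ) (hv : ContDiff ℝ 2 v) (k : Fin d) :
    ContDiff ℝ 1 fun x => P.stress φ v x (stdVec k) := by
  have hd : ∀ i : Fin d, ContDiff ℝ 1 fun x => fderiv ℝ v x (stdVec i) := fun i =>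
    (hv.fderiv_right (m := 1) (by norm_num)).clm_apply contDiff_const
  have hdiv : ContDiff ℝ 1 (vdiv v) := contDiff_vdiv (m := 1) (n := 2) hv (by norm_num)
  have : (fun x => P.stress φ v x (stdVec k)) = fun x => P.η (φ x) • (fderiv ℝ v x (stdVec k)
      + (∑ i, fderiv ℝ v x (stdVec i) k • (stdVec i : Vec d))
      + ((-2 / (d : ℝ)) * vdiv v x) • (stdVec k : Vec d)) := by
    funext x
    simp [Data.stress, adjoint_apply_stdVec]
  rw [this]
  refine (P.contDiff_η.comp hφ).fun_smul (((hd k).add (ContDiff.sum fun i _ =>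
    (contDiff_coord (n := 1) (hd i) k).fun_smul contDiff_const)).add
    ((contDiff_const.mul hdiv).fun_smul contDiff_const))

lemma continuous_ddot {A B : Vec d → Vec d →L[ℝ] Vec d}
    (hA : ∀ k, Continuous fun x => A x (stdVec k)) (hB : ∀ k, Continuous fun x => B x (stdVec k)) :
    Continuous fun x => ddot (A x) (B x) :=
  continuous_finsetSum _ fun k _ => (hA k).inner (hB k)

lemma integral_three_terms {X : Type*} [MeasurableSpace X] {m : Measure X} {a b c : X → ℝ}
    (ha : Integrable a m) (hb : Integrable b m) (hc : Integrable c m) :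
    ∫ x, (a x - b x - 1 / 2 * c x) ∂m = ∫ x, a x ∂m - ∫ x, b x ∂m - 1 / 2 * ∫ x, c x ∂m := by
  have k : Integrable (fun x => a x - b x) m := ha.sub hb
  rw [integral_sub k (hc.const_mul _), integral_sub ha hb, integral_const_mul]

lemma integral_momentum_terms {X : Type*} [MeasurableSpace X] {m : Measure X}
    {a b c e f g h : X → ℝ} (ha : Integrable a m) (hb : Integrable b m) (hc : Integrable c m)
    (he : Integrable e m) (hf : Integrable f m) (hg : Integrable g m) (hh : Integrable h m) :
    ∫ x, (a x + (1 / 2 * b x - 1 / 2 * c x) + e x - f x + g x + h x) ∂m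
      = ∫ x, a x ∂m + (1 / 2 * ∫ x, b x ∂m - 1 / 2 * ∫ x, c x ∂m) + ∫ x, e x ∂m - ∫ x, f x ∂m
        + ∫ x, g x ∂m + ∫ x, h x ∂m := by
  have k1 : Integrable (fun x => 1 / 2 * b x - 1 / 2 * c x) m :=
    (hb.const_mul _).sub (hc.const_mul _)
  have k2 : Integrable (fun x => a x + (1 / 2 * b x - 1 / 2 * c x)) m := ha.add k1
  have k3 : Integrable (fun x => a x + (1 / 2 * b x - 1 / 2 * c x) + e x) m := k2.add he
  have k4 : Integrable (fun x => a x + (1 / 2 * b x - 1 / 2 * c x) + e x - f x) m := k3.sub hf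
  have k5 : Integrable (fun x => a x + (1 / 2 * b x - 1 / 2 * c x) + e x - f x + g x) m :=
    k4.add hg
  rw [integral_add k5 hh, integral_add k4 hg, integral_sub k3 hf, integral_add k2 he,
    integral_add ha k1, integral_sub (hb.const_mul _) (hc.const_mul _), integral_const_mul,
    integral_const_mul]

/-! ### Weak equations at a fixed time -/

section Weak

variable {P : Data d} {T t : ℝ} {Ω : Set (Vec d)} {φ : ℝ → Vec d → ℝ} {v : ℝ → Vec d → Vec d}
  {μ p : ℝ → Vec d → ℝ}

lemma IsSmoothSolution.slice_φ (h : IsSmoothSolution P T Ω φ v μ p) (ht : t ∈ Ioo 0 T)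
    (n : ℕ∞) : ContDiff ℝ n (φ t) :=
  (h.smooth_φ.slice ht).of_le (WithTop.coe_le_coe.mpr le_top)

lemma IsSmoothSolution.slice_v (h : IsSmoothSolution P T Ω φ v μ p) (ht : t ∈ Ioo 0 T)
    (n : ℕ∞) : ContDiff ℝ n (v t) :=
  (h.smooth_v.slice ht).of_le (WithTop.coe_le_coe.mpr le_top)

lemma IsSmoothSolution.slice_μ (h : IsSmoothSolution P T Ω φ v μ p) (ht : t ∈ Ioo 0 T)
    (n : ℕ∞) : ContDiff ℝ n (μ t) :=
  (h.smooth_μ.slice ht).of_le (WithTop.coe_le_coe.mpr le_top)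

lemma IsSmoothSolution.slice_p (h : IsSmoothSolution P T Ω φ v μ p) (ht : t ∈ Ioo 0 T)
    (n : ℕ∞) : ContDiff ℝ n (p t) :=
  (h.smooth_p.slice ht).of_le (WithTop.coe_le_coe.mpr le_top)

lemma IsSmoothSolution.contDiff_pot (h : IsSmoothSolution P T Ω φ v μ p) (ht : t ∈ Ioo 0 T)
    (n : ℕ∞) : ContDiff ℝ n (P.pot (μ t) (p t)) :=
  (h.slice_μ ht n).add (contDiff_const.mul (h.slice_p ht n))

lemma IsSmoothSolution.contDiff_flux (h : IsSmoothSolution P T Ω φ v μ p) (ht : t ∈ Ioo 0 T) :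
    ContDiff ℝ 1 (P.flux (φ t) (P.pot (μ t) (p t))) :=
  P.contDiff_flux (h.slice_φ ht 1) (h.contDiff_pot ht 2)

lemma IsSmoothSolution.contDiff_transport (h : IsSmoothSolution P T Ω φ v μ p)
    (ht : t ∈ Ioo 0 T) : ContDiff ℝ 1 fun x => φ t x • v t x :=
  (h.slice_φ ht 1).fun_smul (h.slice_v ht 1)

lemma IsSmoothSolution.contDiff_momentum (h : IsSmoothSolution P T Ω φ v μ p)
    (ht : t ∈ Ioo 0 T) : ContDiff ℝ 1 fun x => P.ρ (φ t x) • v t x :=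
  (P.contDiff_ρ.comp (h.slice_φ ht 1)).fun_smul (h.slice_v ht 1)

lemma IsSmoothSolution.hasDerivAt_ρ (h : IsSmoothSolution P T Ω φ v μ p) (ht : t ∈ Ioo 0 T)
    (x : Vec d) : HasDerivAt (fun s => P.ρ (φ s x))
      ((P.ρ₁ - P.ρ₂) / 2 * deriv (fun s => φ s x) t) t :=
  (P.hasDerivAt_ρ _).comp t (h.smooth_φ.hasDerivAt ht x)

lemma IsSmoothSolution.contDiff_dt_φ (h : IsSmoothSolution P T Ω φ v μ p) (ht : t ∈ Ioo 0 T)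
    (n : ℕ∞) : ContDiff ℝ n fun x => deriv (fun s => φ s x) t :=
  (h.smooth_φ.dt.slice ht).of_le (WithTop.coe_le_coe.mpr le_top)

lemma IsSmoothSolution.continuous_dt_ρ (h : IsSmoothSolution P T Ω φ v μ p)
    (ht : t ∈ Ioo 0 T) : Continuous fun x => deriv (fun s => P.ρ (φ s x)) t := by
  simp only [(h.hasDerivAt_ρ ht _).deriv]
  exact continuous_const.mul (h.contDiff_dt_φ ht 0).continuous

lemma IsSmoothSolution.continuous_dt_v (h : IsSmoothSolution P T Ω φ v μ p)
    (ht : t ∈ Ioo 0 T) : Continuous fun x => deriv (fun s => v s x) t :=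
  (h.smooth_v.dt.slice ht).continuous

lemma IsSmoothSolution.weak_phase (h : IsSmoothSolution P T Ω φ v μ p) (hΩ : IsOpen Ω)
    (hΩb : Bornology.IsBounded Ω) (ht : t ∈ Ioo 0 T) {ψ : Vec d → ℝ} (hψ : ContDiff ℝ 1 ψ)
    (h1 : ∫ x in Ω, vdiv (fun z => ψ z • φ t z • v t z) x = 0)
    (h2 : ∫ x in Ω, vdiv (fun z => ψ z • P.flux (φ t) (P.pot (μ t) (p t)) z) x = 0) :
    pair Ω (fun x => deriv (fun s => φ s x) t) ψ - pair Ω (fun x => φ t x • v t x) (gradient ψ)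
      + pair Ω (P.flux (φ t) (P.pot (μ t) (p t))) (gradient ψ) = 0 := by
  have hF := h.contDiff_transport ht
  have hJ := h.contDiff_flux ht
  have e1 := pair_vdiv hΩb hψ hF h1
  have e2 := pair_vdiv hΩb hψ hJ h2
  rw [pair_congr_left hΩ (a' := fun x => vdiv (P.flux (φ t) (P.pot (μ t) (p t))) x
      - vdiv (fun z => φ t z • v t z) x) (fun x hx => by linarith [h.eq_phase t ht x hx]),
    pair_sub_left hΩb (continuous_vdiv hJ) (continuous_vdiv hF) hψ.continuous, e1, e2]
  ring

lemma IsSmoothSolution.weak_chem (h : IsSmoothSolution P T Ω φ v μ p) (hΩ : IsOpen Ω)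
    (hΩb : Bornology.IsBounded Ω) (ht : t ∈ Ioo 0 T) {ξ : Vec d → ℝ} (hξ : ContDiff ℝ 1 ξ)
    (h1 : ∫ x in Ω, vdiv (fun z => ξ z • gradient (φ t) z) x = 0) :
    pair Ω (μ t) ξ - P.γ * pair Ω (gradient (φ t)) (gradient ξ)
      - pair Ω (fun x => deriv P.f (φ t x)) ξ = 0 := by
  have hF : ContDiff ℝ 1 (gradient (φ t)) :=
    contDiff_gradient (m := 1) (n := 2) (h.slice_φ ht 2) (by norm_num)
  have hf : Continuous fun x => deriv P.f (φ t x) :=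
    (P.f_smooth.continuous_deriv le_rfl).comp (h.slice_φ ht 0).continuous
  rw [pair_congr_left hΩ (a' := fun x => deriv P.f (φ t x) - P.γ • vdiv (gradient (φ t)) x)
      (fun x hx => by
        have := h.eq_chem t ht x hx
        rw [lap] at this
        rw [smul_eq_mul]
        linarith),
    pair_sub_left hΩb hf (a' := fun x => P.γ • vdiv (gradient (φ t)) x)
      (continuous_const.mul (continuous_vdiv hF)) hξ.continuous,
    pair_smul_left, pair_vdiv hΩb hξ hF h1]
  ring

/-- Not restricted to mean-free q: the energy law tests with p, and the gravity balance with y. -/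
lemma IsSmoothSolution.weak_div (h : IsSmoothSolution P T Ω φ v μ p) (hΩ : IsOpen Ω)
    (hΩb : Bornology.IsBounded Ω) (ht : t ∈ Ioo 0 T) {q : Vec d → ℝ} (hq : ContDiff ℝ 1 q)
    (h1 : ∫ x in Ω, vdiv (fun z => q z • P.flux (φ t) (P.pot (μ t) (p t)) z) x = 0) :
    pair Ω (vdiv (v t)) q
      + P.α * pair Ω (P.flux (φ t) (P.pot (μ t) (p t))) (gradient q) = 0 := by
  have hJ := h.contDiff_flux ht
  rw [pair_congr_left hΩ (a' := fun x => P.α • vdiv (P.flux (φ t) (P.pot (μ t) (p t))) x)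
      (fun x hx => by rw [smul_eq_mul]; linarith [h.eq_div t ht x hx]),
    pair_smul_left, pair_vdiv hΩb hq hJ h1]
  ring

lemma IsSmoothSolution.weak_mom (h : IsSmoothSolution P T Ω φ v μ p) (hΩ : IsOpen Ω)
    (hΩb : Bornology.IsBounded Ω) (ht : t ∈ Ioo 0 T) {w : Vec d → Vec d} (hw : ContDiff ℝ 1 w)
    (h1 : ∫ x in Ω, vdiv (fun z => p t z • w z) x = 0)
    (h2 : ∫ x in Ω, vdiv (fun z => (inner ℝ (v t z) (w z) : ℝ) • P.ρ (φ t z) • v t z) x = 0)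
    (h3 : ∫ x in Ω, vdiv (transposeApply (P.stress (φ t) (v t)) w) x = 0) :
    pair Ω (fun x => (deriv (fun s => P.ρ (φ s x)) t / 2) • v t x
        + P.ρ (φ t x) • deriv (fun s => v s x) t) w
      + cskw Ω (fun x => P.ρ (φ t x) • v t x) (v t) w
      + tpair Ω (P.stress (φ t) (v t)) (fderiv ℝ w)
      - pair Ω (p t) (vdiv w)
      + pair Ω (fun x => φ t x • gradient (μ t) x) w
      + pair Ω (fun x => P.ρ (φ t x) • (P.g • P.j)) w = 0 := by
  have hv := h.slice_v ht 1
  have hp := h.slice_p ht 1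
  have hu := h.contDiff_momentum ht
  have hS := P.contDiff_stress (h.slice_φ ht 1) (h.slice_v ht 2)
  have hvw : ContDiff ℝ 1 fun z => (inner ℝ (v t z) (w z) : ℝ) := hv.inner ℝ hw
  set u : Vec d → Vec d := fun x => P.ρ (φ t x) • v t x with hudef
  set S := P.stress (φ t) (v t) with hSdef
  have i1 := integrableOn_inner hΩb (b := w) (a := fun x => (deriv (fun s => P.ρ (φ s x)) t / 2) • v t x
        + P.ρ (φ t x) • deriv (fun s => v s x) t)
    ((((h.continuous_dt_ρ ht).div_const 2).smul hv.continuous).add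
      ((P.contDiff_ρ (n := 0).continuous.comp (h.slice_φ ht 0).continuous).smul
        (h.continuous_dt_v ht))) hw.continuous
  have i2 := integrableOn_inner hΩb (a := fun x => fderiv ℝ (v t) x (u x)) (b := w)
    ((hv.continuous_fderiv (by simp)).clm_apply hu.continuous) hw.continuous
  have i3 := integrableOn_inner hΩb (a := fun x => fderiv ℝ w x (u x)) (b := v t)
    ((hw.continuous_fderiv (by simp)).clm_apply hu.continuous) hv.continuous
  have i4 : IntegrableOn (fun x => ddot (S x) (fderiv ℝ w x)) Ω :=
    integrableOn_of_isBounded hΩb (continuous_ddot (fun k => (hS k).continuous) fun k =>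
      (hw.continuous_fderiv (by simp)).clm_apply continuous_const)
  have i5 := integrableOn_inner hΩb (a := p t) (b := vdiv w) hp.continuous (continuous_vdiv hw)
  have i6 := integrableOn_inner hΩb (b := w) (a := fun x => φ t x • gradient (μ t) x)
    ((h.slice_φ ht 0).continuous.smul
      (contDiff_gradient (m := 0) (n := 1) (h.slice_μ ht 1) (by norm_num)).continuous) hw.continuous
  have i7 := integrableOn_inner hΩb (b := w) (a := fun x => P.ρ (φ t x) • (P.g • P.j))
    ((P.contDiff_ρ (n := 0).continuous.comp (h.slice_φ ht 0).continuous).smul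
      continuous_const) hw.continuous
  have j1 := integrableOn_of_isBounded hΩb (continuous_vdiv (hp.fun_smul hw))
  have j2 := integrableOn_of_isBounded hΩb (continuous_vdiv (hvw.fun_smul hu))
  have j3 := integrableOn_of_isBounded hΩb (continuous_vdiv (contDiff_transposeApply hS hw))
  -- Pointwise, the weak integrand equals div(Sᵀw) - div(pw) - ½ div((v·w)ρv). The last divergence
  -- converts ½ div(ρv) v + (ρv·∇)v, tested with w, into the skew-symmetric convection form.
  have key : ∀ x ∈ Ω,
      inner ℝ ((deriv (fun s => P.ρ (φ s x)) t / 2) • v t x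
        + P.ρ (φ t x) • deriv (fun s => v s x) t) (w x)
      + (1 / 2 * inner ℝ (fderiv ℝ (v t) x (u x)) (w x)
        - 1 / 2 * inner ℝ (fderiv ℝ w x (u x)) (v t x))
      + ddot (S x) (fderiv ℝ w x) - inner ℝ (p t x) (vdiv w x)
      + inner ℝ (φ t x • gradient (μ t) x) (w x)
      + inner ℝ (P.ρ (φ t x) • (P.g • P.j)) (w x)
      = vdiv (transposeApply S w) x - vdiv (fun z => p t z • w z) x
        - 1 / 2 * vdiv (fun z => (inner ℝ (v t z) (w z) : ℝ) • u z) x := by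
    intro x hx
    have hm := congrArg (fun a => (inner ℝ a (w x) : ℝ)) (h.eq_mom t ht x hx)
    have e1 := vdiv_smul (hp.differentiable (by simp) x) (hw.differentiable (by simp) x)
    have e2 := vdiv_smul (hvw.differentiable (by simp) x) (hu.differentiable (by simp) x)
    rw [inner_gradient_left (u := fun z => (inner ℝ (v t z) (w z) : ℝ)),
      fderiv_inner_apply ℝ (hv.differentiable (by simp) x) (hw.differentiable (by simp) x),
      real_inner_comm (fderiv ℝ w x _)] at e2
    rw [vdiv_transposeApply hS hw, e1, e2]
    simp only [inner_add_left, inner_sub_left, real_inner_smul_left, neg_smul, smul_neg,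
      inner_neg_left] at hm ⊢
    simp only [RCLike.inner_apply, conj_trivial]
    simp only [hudef] at hm ⊢
    linarith
  have hI := setIntegral_congr_fun (μ := volume) hΩ.measurableSet key
  rw [integral_momentum_terms i1 i2 i3 i4 i5 i6 i7, integral_three_terms j3 j1 j2, h1, h2, h3]
    at hI
  simp only [pair, cskw, tpair]
  linarith

end Weak

/-! ### Conservation laws, time derivative of the energy, dissipation and gravity -/

section Conservation

variable {P : Data d} {T t : ℝ} {Ω : Set (Vec d)} {φ : ℝ → Vec d → ℝ} {v : ℝ → Vec d → Vec d}
  {μ p : ℝ → Vec d → ℝ}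

lemma SmoothField.continuousOn {F : Type} [NormedAddCommGroup F] [NormedSpace ℝ F]
    {u : ℝ → Vec d → F} (h : SmoothField T u) :
    ContinuousOn (fun z : ℝ × Vec d => u z.1 z.2) (Ioo 0 T ×ˢ univ) :=
  ContDiffOn.continuousOn h

lemma IsSmoothSolution.hasDerivAt_integral_φ (h : IsSmoothSolution P T Ω φ v μ p)
    (hΩb : Bornology.IsBounded Ω) (ht : t ∈ Ioo 0 T) :
    HasDerivAt (fun s => ∫ x in Ω, φ s x) (∫ x in Ω, deriv (fun s => φ s x) t) t :=
  hasDerivAt_setIntegral hΩb ht (fun _ hs => (h.smooth_φ.slice hs).continuous)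
    (fun _ hs x => h.smooth_φ.hasDerivAt hs x) h.smooth_φ.dt.continuousOn

lemma IsSmoothSolution.massConserved (h : IsSmoothSolution P T Ω φ v μ p)
    (hΩb : Bornology.IsBounded Ω) (ht : t ∈ Ioo 0 T)
    (h0 : ∫ x in Ω, deriv (fun s => φ s x) t = 0) : MassConserved Ω φ t := by
  have := h.hasDerivAt_integral_φ hΩb ht
  rw [h0] at this
  simpa [MassConserved, pair_real] using this

lemma IsSmoothSolution.densityConserved (h : IsSmoothSolution P T Ω φ v μ p)
    (hΩb : Bornology.IsBounded Ω) (ht : t ∈ Ioo 0 T)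
    (h0 : ∫ x in Ω, deriv (fun s => φ s x) t = 0) : DensityConserved P Ω φ t := by
  have := hasDerivAt_setIntegral hΩb ht (e := fun s x => P.ρ (φ s x))
    (e' := fun s x => (P.ρ₁ - P.ρ₂) / 2 * deriv (fun s => φ s x) s)
    (fun s hs => P.contDiff_ρ (n := 0).continuous.comp (h.smooth_φ.slice hs).continuous)
    (fun s hs x => h.hasDerivAt_ρ hs x) (continuousOn_const.mul h.smooth_φ.dt.continuousOn)
  rw [integral_const_mul, h0, mul_zero] at this
  simpa [DensityConserved, pair_real] using this

lemma Data.hasFDerivAt_y (P : Data d) (x : Vec d) : HasFDerivAt P.y (innerSL ℝ P.j) x :=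
  (innerSL ℝ P.j).hasFDerivAt

lemma Data.contDiff_y (P : Data d) {n : WithTop ℕ∞} : ContDiff ℝ n P.y :=
  (innerSL ℝ P.j).contDiff

lemma Data.gradient_y (P : Data d) (x : Vec d) : gradient P.y x = P.j := by
  refine ext_inner_right ℝ fun e => ?_
  rw [inner_gradient_left, (P.hasFDerivAt_y x).fderiv, innerSL_apply_apply]

/-- The time derivative of the energy. -/
lemma IsSmoothSolution.hasDerivAt_energy (h : IsSmoothSolution P T Ω φ v μ p)
    (hΩb : Bornology.IsBounded Ω) (ht : t ∈ Ioo 0 T) :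
    HasDerivAt (fun s => P.energy Ω (φ s) (v s))
      (P.γ * pair Ω (gradient (φ t)) (gradient fun x => deriv (fun s => φ s x) t)
        + pair Ω (fun x => deriv P.f (φ t x)) (fun x => deriv (fun s => φ s x) t)
        + pair Ω (fun x => (deriv (fun s => P.ρ (φ s x)) t / 2) • v t x
            + P.ρ (φ t x) • deriv (fun s => v s x) t) (v t)
        + P.g * ((P.ρ₁ - P.ρ₂) / 2) * pair Ω (fun x => deriv (fun s => φ s x) t) P.y) t := by
  set c := (P.ρ₁ - P.ρ₂) / 2 with hc
  have hφc := h.smooth_φ.continuousOn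
  have hvc := h.smooth_v.continuousOn
  have hφt := h.smooth_φ.dt.continuousOn
  have hvt := h.smooth_v.dt.continuousOn
  have hyc : Continuous P.y := P.contDiff_y (n := 0).continuous
  have hρc : Continuous P.ρ := P.contDiff_ρ (n := 0).continuous
  have hf' : Continuous (deriv P.f) := P.f_smooth.continuous_deriv le_rfl
  have hg1 := h.smooth_φ.gradient.continuousOn
  have hg2 := h.smooth_φ.dt.gradient.continuousOn
  have key := hasDerivAt_setIntegral hΩb ht
    (e := fun s x => P.γ / 2 * ‖gradient (φ s) x‖ ^ 2 + P.f (φ s x)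
      + P.ρ (φ s x) / 2 * ‖v s x‖ ^ 2 + P.g * P.ρ (φ s x) * P.y x)
    (e' := fun s x => P.γ * inner ℝ (gradient (φ s) x)
        (gradient (fun y => deriv (fun r => φ r y) s) x)
      + deriv P.f (φ s x) * deriv (fun r => φ r x) s
      + (c * deriv (fun r => φ r x) s / 2 * ‖v s x‖ ^ 2
        + P.ρ (φ s x) * inner ℝ (v s x) (deriv (fun r => v r x) s))
      + P.g * c * (deriv (fun r => φ r x) s * P.y x)) ?_ ?_ ?_
  · have i1 := integrableOn_inner hΩb (a := gradient (φ t))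
      (b := gradient fun x => deriv (fun s => φ s x) t)
      (contDiff_gradient (m := 0) (n := 1) (h.slice_φ ht 1) (by norm_num)).continuous
      (contDiff_gradient (m := 0) (n := 1) (h.contDiff_dt_φ ht 1) (by norm_num)).continuous
    have i2 : IntegrableOn (fun x => deriv P.f (φ t x) * deriv (fun s => φ s x) t) Ω :=
      integrableOn_of_isBounded hΩb
      ((hf'.comp (h.slice_φ ht 0).continuous).mul (h.contDiff_dt_φ ht 0).continuous)
    have i3 := integrableOn_inner hΩb (b := v t)
      (a := fun x => (deriv (fun s => P.ρ (φ s x)) t / 2) • v t x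
        + P.ρ (φ t x) • deriv (fun s => v s x) t)
      ((((h.continuous_dt_ρ ht).div_const 2).smul (h.slice_v ht 0).continuous).add
        ((hρc.comp (h.slice_φ ht 0).continuous).smul (h.continuous_dt_v ht)))
      (h.slice_v ht 0).continuous
    have i4 : IntegrableOn (fun x => deriv (fun s => φ s x) t * P.y x) Ω :=
      integrableOn_of_isBounded hΩb
      ((h.contDiff_dt_φ ht 0).continuous.mul hyc)
    have k1 : IntegrableOn (fun x => P.γ * inner ℝ (gradient (φ t) x)
        (gradient (fun y => deriv (fun r => φ r y) t) x)
      + deriv P.f (φ t x) * deriv (fun r => φ r x) t) Ω := (i1.const_mul _).add i2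
    have k2 : IntegrableOn (fun x => P.γ * inner ℝ (gradient (φ t) x)
        (gradient (fun y => deriv (fun r => φ r y) t) x)
      + deriv P.f (φ t x) * deriv (fun r => φ r x) t
      + inner ℝ ((deriv (fun s => P.ρ (φ s x)) t / 2) • v t x
        + P.ρ (φ t x) • deriv (fun s => v s x) t) (v t x)) Ω := k1.add i3
    -- The splitting ½v ∂ₜρ + ρ ∂ₜv of the inertia term, tested with v, is exactly ∂ₜ(½ρ|v|²).
    have e3 : ∀ x, c * deriv (fun r => φ r x) t / 2 * ‖v t x‖ ^ 2
        + P.ρ (φ t x) * inner ℝ (v t x) (deriv (fun r => v r x) t)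
        = inner ℝ ((deriv (fun s => P.ρ (φ s x)) t / 2) • v t x
          + P.ρ (φ t x) • deriv (fun s => v s x) t) (v t x) := by
      intro x
      rw [inner_add_left, real_inner_smul_left, real_inner_smul_left, real_inner_self_eq_norm_sq,
        (h.hasDerivAt_ρ ht x).deriv, real_inner_comm (v t x)]
    simp only [e3] at key
    rw [integral_add k2 (i4.const_mul _), integral_add k1 i3, integral_add (i1.const_mul _) i2,
      integral_const_mul, integral_const_mul] at key
    rw [pair_real, pair_real]
    exact key
  · intro s hs
    have h1 := (h.slice_φ hs 0).continuous
    have h2 := (h.slice_v hs 0).continuous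
    have h3 := (contDiff_gradient (m := 0) (n := 1) (h.slice_φ hs 1) (by norm_num)).continuous
    have h4 := P.f_smooth.continuous
    fun_prop
  · intro s hs x
    have d1 := h.smooth_φ.hasDerivAt hs x
    have d2 := (h.smooth_φ.hasDerivAt_gradient hs x).norm_sq.const_mul (P.γ / 2)
    have d3 := ((P.f_smooth.differentiable (by simp)) (φ s x)).hasDerivAt.comp s d1
    have d4 := ((h.hasDerivAt_ρ hs x).div_const 2).mul (h.smooth_v.hasDerivAt hs x).norm_sq
    have d5 := ((h.hasDerivAt_ρ hs x).const_mul P.g).mul_const (P.y x)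
    refine (((d2.add d3).add d4).add d5).congr_deriv ?_
    rw [hc]
    ring
  · have h1 : ContinuousOn (fun z : ℝ × Vec d => deriv P.f (φ z.1 z.2)) (Ioo 0 T ×ˢ univ) :=
      hf'.comp_continuousOn hφc
    have h2 : ContinuousOn (fun z : ℝ × Vec d => P.ρ (φ z.1 z.2)) (Ioo 0 T ×ˢ univ) :=
      hρc.comp_continuousOn hφc
    have h3 : ContinuousOn (fun z : ℝ × Vec d => P.y z.2) (Ioo 0 T ×ˢ univ) :=
      (hyc.comp continuous_snd).continuousOn
    exact ((((continuousOn_const.mul (hg1.inner hg2)).add (h1.mul hφt)).add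
      ((((continuousOn_const.mul hφt).div_const 2).mul (hvc.norm.pow 2)).add
        (h2.mul (hvc.inner hvt)))).add (continuousOn_const.mul (hφt.mul h3)))

lemma gradient_pot {x : Vec d} (hμ : DifferentiableAt ℝ (μ t) x)
    (hp : DifferentiableAt ℝ (p t) x) :
    gradient (P.pot (μ t) (p t)) x = gradient (μ t) x + P.α • gradient (p t) x := by
  refine ext_inner_right ℝ fun e => ?_
  have : HasFDerivAt (P.pot (μ t) (p t)) (fderiv ℝ (μ t) x + P.α • fderiv ℝ (p t) x) x :=
    hμ.hasFDerivAt.add (hp.hasFDerivAt.const_mul P.α)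
  rw [inner_add_left, real_inner_smul_left, inner_gradient_left, inner_gradient_left,
    inner_gradient_left, this.fderiv]
  rfl

/-- Splitting ∇(μ+αp) separates the mobility dissipation into the parts produced by testing the
phase equation with μ and the divergence equation with p. -/
lemma IsSmoothSolution.dissipation_eq (h : IsSmoothSolution P T Ω φ v μ p)
    (hΩb : Bornology.IsBounded Ω) (ht : t ∈ Ioo 0 T) :
    P.dissipation Ω (φ t) (P.pot (μ t) (p t)) (v t)
      = pair Ω (P.flux (φ t) (P.pot (μ t) (p t))) (gradient (μ t))
        + P.α * pair Ω (P.flux (φ t) (P.pot (μ t) (p t))) (gradient (p t))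
        + tpair Ω (P.stress (φ t) (v t)) (fderiv ℝ (v t)) := by
  have hJ := (h.contDiff_flux ht).continuous
  have i1 := integrableOn_inner hΩb (b := gradient (μ t)) hJ
    (contDiff_gradient (m := 0) (n := 1) (h.slice_μ ht 1) (by norm_num)).continuous
  have i2 := integrableOn_inner hΩb (b := gradient (p t)) hJ
    (contDiff_gradient (m := 0) (n := 1) (h.slice_p ht 1) (by norm_num)).continuous
  have i3 : IntegrableOn (fun x => ddot (P.stress (φ t) (v t) x) (fderiv ℝ (v t) x)) Ω :=
    integrableOn_of_isBounded hΩb (continuous_ddot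
      (fun k => (P.contDiff_stress (h.slice_φ ht 1) (h.slice_v ht 2) k).continuous) fun k =>
      ((h.slice_v ht 1).continuous_fderiv (by simp)).clm_apply continuous_const)
  have i4 : IntegrableOn (fun x =>
      inner ℝ (P.flux (φ t) (P.pot (μ t) (p t)) x) (gradient (μ t) x)
      + P.α * inner ℝ (P.flux (φ t) (P.pot (μ t) (p t)) x) (gradient (p t) x)) Ω :=
    i1.add (i2.const_mul _)
  simp only [pair, tpair]
  rw [← integral_const_mul, ← integral_add i1 (i2.const_mul _), ← integral_add i4 i3]
  refine integral_congr_ae (Eventually.of_forall fun x => ?_)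
  have hg := gradient_pot (P := P) ((h.slice_μ ht 1).differentiable (by simp) x)
    ((h.slice_p ht 1).differentiable (by simp) x)
  have : inner ℝ (gradient (P.pot (μ t) (p t)) x) (P.M (φ t x) (gradient (P.pot (μ t) (p t)) x))
      = inner ℝ (P.flux (φ t) (P.pot (μ t) (p t)) x) (gradient (μ t) x)
      + P.α * inner ℝ (P.flux (φ t) (P.pot (μ t) (p t)) x) (gradient (p t) x) := by
    rw [← real_inner_smul_right, ← inner_add_right, ← hg, real_inner_comm]
    rfl
  simp only [this]

/-- Work of gravity: the potential energy changes at the rate at which gravity does work. -/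
lemma IsSmoothSolution.gravity_work (h : IsSmoothSolution P T Ω φ v μ p)
    (hΩb : Bornology.IsBounded Ω) (ht : t ∈ Ioo 0 T)
    (hphase : pair Ω (fun x => deriv (fun s => φ s x) t) P.y
      - pair Ω (fun x => φ t x • v t x) (gradient P.y)
      + pair Ω (P.flux (φ t) (P.pot (μ t) (p t))) (gradient P.y) = 0)
    (hdiv : pair Ω (vdiv (v t)) P.y
      + P.α * pair Ω (P.flux (φ t) (P.pot (μ t) (p t))) (gradient P.y) = 0)
    (h0 : ∫ x in Ω, vdiv (fun z => P.y z • v t z) x = 0) :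
    pair Ω (fun x => P.ρ (φ t x) • (P.g • P.j)) (v t)
      = P.g * ((P.ρ₁ - P.ρ₂) / 2) * pair Ω (fun x => deriv (fun s => φ s x) t) P.y := by
  have hv := h.slice_v ht 1
  have hg : gradient P.y = fun _ => P.j := funext P.gradient_y
  rw [pair_vdiv hΩb P.contDiff_y hv h0, hg] at hdiv
  rw [hg] at hphase
  have i1 := integrableOn_inner hΩb (a := v t) (b := fun _ => P.j) hv.continuous continuous_const
  have i2 := integrableOn_inner hΩb (a := fun x => φ t x • v t x) (b := fun _ => P.j)
    (h.contDiff_transport ht).continuous continuous_const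
  have e : pair Ω (fun x => P.ρ (φ t x) • (P.g • P.j)) (v t)
      = P.g * ((P.ρ₁ + P.ρ₂) / 2) * pair Ω (v t) (fun _ => P.j)
        + P.g * ((P.ρ₁ - P.ρ₂) / 2) * pair Ω (fun x => φ t x • v t x) (fun _ => P.j) := by
    simp only [pair]
    rw [← integral_const_mul, ← integral_const_mul,
      ← integral_add (i1.const_mul _) (i2.const_mul _)]
    refine integral_congr_ae (Eventually.of_forall fun x => ?_)
    simp only [real_inner_smul_left, real_inner_smul_right, P.ρ_eq, real_inner_comm P.j]
    ring
  rw [e]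
  -- The two parts of the affine density weight the two tested equations; what remains is a multiple
  -- of the diffusive flux, killed by `sum_mul_α`.
  linear_combination (-P.g * ((P.ρ₁ + P.ρ₂) / 2)) * hdiv - P.g * ((P.ρ₁ - P.ρ₂) / 2) * hphase
    + P.g * pair Ω (P.flux (φ t) (P.pot (μ t) (p t))) (fun _ => P.j) * P.sum_mul_α

end Conservation

/-! ### Choice of test functions and the energy law -/

section Assembly

variable {P : Data d} {T t : ℝ} {Ω : Set (Vec d)} {φ : ℝ → Vec d → ℝ} {v : ℝ → Vec d → Vec d}
  {μ p : ℝ → Vec d → ℝ}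

/-- A class `N` of fields whose divergence has zero mean, rich enough for the test spaces `V`, `X`,
yields the variational formulation, both conservation laws and the energy law. -/
theorem IsSmoothSolution.conclusions (h : IsSmoothSolution P T Ω φ v μ p) (hΩ : IsOpen Ω)
    (hΩb : Bornology.IsBounded Ω) (ht : t ∈ Ioo 0 T) {V : Set (Vec d → ℝ)}
    {X : Set (Vec d → Vec d)} {N : (Vec d → Vec d) → Prop}
    (hN : ∀ F, ContDiff ℝ 1 F → N F → ∫ x in Ω, vdiv F x = 0)
    (hV : ∀ ψ ∈ V, ContDiff ℝ 1 ψ) (hX : ∀ w ∈ X, ContDiff ℝ 1 w)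
    (hVv : ∀ ψ ∈ V, N fun z => ψ z • v t z)
    (hVφv : ∀ ψ ∈ V, N fun z => ψ z • φ t z • v t z)
    (hVJ : ∀ ψ ∈ V, N fun z => ψ z • P.flux (φ t) (P.pot (μ t) (p t)) z)
    (hVφ : ∀ ψ ∈ V, N fun z => ψ z • gradient (φ t) z)
    (hXp : ∀ w ∈ X, N fun z => p t z • w z)
    (hXv : ∀ w ∈ X, N fun z => (inner ℝ (v t z) (w z) : ℝ) • P.ρ (φ t z) • v t z)
    (hXS : ∀ w ∈ X, N (transposeApply (P.stress (φ t) (v t)) w))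
    (h1V : (fun _ => 1) ∈ V) (hμV : μ t ∈ V) (hpV : p t ∈ V)
    (hφV : (fun x => deriv (fun s => φ s x) t) ∈ V) (hvX : v t ∈ X) :
    WeakFormulation P Ω V X φ v μ p t ∧ MassConserved Ω φ t ∧ DensityConserved P Ω φ t ∧
      (P.g = 0 ∨ P.y ∈ V → EnergyLaw P Ω φ v μ p t) := by
  have hu := h.contDiff_transport ht
  have hJ := h.contDiff_flux ht
  have hφ : ContDiff ℝ 1 (gradient (φ t)) :=
    contDiff_gradient (m := 1) (n := 2) (h.slice_φ ht 2) (by norm_num)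
  have phase : ∀ ψ ∈ V, _ := fun ψ hψ => h.weak_phase hΩ hΩb ht (hV ψ hψ)
    (hN _ ((hV ψ hψ).fun_smul hu) (hVφv ψ hψ)) (hN _ ((hV ψ hψ).fun_smul hJ) (hVJ ψ hψ))
  have chem : ∀ ξ ∈ V, _ := fun ξ hξ => h.weak_chem hΩ hΩb ht (hV ξ hξ)
    (hN _ ((hV ξ hξ).fun_smul hφ) (hVφ ξ hξ))
  have div : ∀ q ∈ V, _ := fun q hq => h.weak_div hΩ hΩb ht (hV q hq)
    (hN _ ((hV q hq).fun_smul hJ) (hVJ q hq))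
  have mom : ∀ w ∈ X, _ := fun w hw => h.weak_mom hΩ hΩb ht (hX w hw)
    (hN _ ((h.slice_p ht 1).fun_smul (hX w hw)) (hXp w hw))
    (hN _ (((h.slice_v ht 1).inner ℝ (hX w hw)).fun_smul (h.contDiff_momentum ht)) (hXv w hw))
    (hN _ (contDiff_transposeApply (P.contDiff_stress (h.slice_φ ht 1) (h.slice_v ht 2))
      (hX w hw)) (hXS w hw))
  -- The test function 1 has zero gradient, so only the time derivative survives.
  have hmean : ∫ x in Ω, deriv (fun s => φ s x) t = 0 := by
    have h1 := phase _ h1V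
    have hg : gradient (fun _ : Vec d => (1 : ℝ)) = fun _ => 0 := by
      funext x; simp [gradient]
    rw [hg, pair_real] at h1
    simpa [pair] using h1
  refine ⟨⟨phase, chem, mom, fun q hq _ => div q hq⟩, h.massConserved hΩb ht hmean,
    h.densityConserved hΩb ht hmean, fun hg => ?_⟩
  have hgrav : pair Ω (fun x => P.ρ (φ t x) • (P.g • P.j)) (v t)
      = P.g * ((P.ρ₁ - P.ρ₂) / 2) * pair Ω (fun x => deriv (fun s => φ s x) t) P.y := by
    rcases hg with hg | hy
    · simp [hg, pair]
    · exact h.gravity_work hΩb ht (phase _ hy) (div _ hy)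
        (hN _ (P.contDiff_y.fun_smul (h.slice_v ht 1)) (hVv _ hy))
  have e1 := phase _ hμV
  have e2 := chem _ hφV
  have e3 := div _ hpV
  have e4 := mom _ hvX
  have hskw : cskw Ω (fun x => P.ρ (φ t x) • v t x) (v t) (v t) = 0 := by
    rw [cskw, sub_self]
  have hcap : pair Ω (fun x => φ t x • gradient (μ t) x) (v t)
      = pair Ω (fun x => φ t x • v t x) (gradient (μ t)) := by
    unfold pair
    congr 1 with x
    rw [real_inner_smul_left, real_inner_smul_left, real_inner_comm]
  rw [hskw, hcap] at e4
  rw [pair_comm (μ t)] at e2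
  rw [pair_comm (vdiv (v t))] at e3
  refine (h.hasDerivAt_energy hΩb ht).congr_deriv ?_
  rw [h.dissipation_eq hΩb ht]
  -- The capillary terms cancel between `e1` and `e4`, the terms ⟨∂ₜφ, μ⟩ between `e1` and `e2`, and
  -- the pressure terms between `e3` and `e4`.
  linear_combination e1 - e2 + e3 + e4 - hgrav

end Assembly

/-! ### Periodicity of derived fields -/

section Periodic

variable {L : ℝ} {F : Type}

lemma IsPeriodic.fderiv [NormedAddCommGroup F] [NormedSpace ℝ F] {u : Vec d → F}
    (hu : IsPeriodic L u) : IsPeriodic L (fderiv ℝ u) := fun x k => by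
  rw [← fderiv_comp_add_right]
  congr 1
  funext y
  exact hu y k

lemma IsPeriodic.gradient {u : Vec d → ℝ} (hu : IsPeriodic L u) :
    IsPeriodic L (gradient u) := fun x k => by
  simp only [_root_.gradient, hu.fderiv x k]

lemma IsPeriodic.flux {P : Data d} {φ χ : Vec d → ℝ} (hφ : IsPeriodic L φ)
    (hχ : IsPeriodic L χ) : IsPeriodic L (P.flux φ χ) := fun x k => by
  simp only [Data.flux, hφ x k, hχ.gradient x k]

lemma IsPeriodic.stress {P : Data d} {φ : Vec d → ℝ} {v : Vec d → Vec d} (hφ : IsPeriodic L φ)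
    (hv : IsPeriodic L v) : IsPeriodic L (P.stress φ v) := fun x k => by
  simp only [Data.stress, vdiv, hφ x k, hv.fderiv x k]

end Periodic

end NSCH

end

/-! ### The wall and periodic settings -/

theorem mainTheorem2 (d : ℕ) (hd : d = 2 ∨ d = 3) (P : NSCH.Data d) (T : ℝ)
    (φ : ℝ → NSCH.Vec d → ℝ) (v : ℝ → NSCH.Vec d → NSCH.Vec d) (μ p : ℝ → NSCH.Vec d → ℝ) :
    (∀ Ω Γ₁ Γ₂ : Set (NSCH.Vec d),
      NSCH.IsBoundedLipschitzDomain Ω →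
      NSCH.IsSmoothSolution P T Ω φ v μ p →
      NSCH.WallConditions P T Ω Γ₁ Γ₂ φ v μ p →
      ∀ t ∈ Set.Ioo 0 T,
        NSCH.WeakFormulation P Ω {ψ | ContDiff ℝ ∞ ψ}
          {w | ContDiff ℝ ∞ w ∧ NSCH.NoPenetration Ω Γ₁ Γ₂ w} φ v μ p t ∧
        NSCH.MassConserved Ω φ t ∧
        NSCH.DensityConserved P Ω φ t ∧
        NSCH.EnergyLaw P Ω φ v μ p t) ∧
    (∀ (a : NSCH.Vec d) (L : ℝ), 0 < L →
      NSCH.IsSmoothSolution P T (NSCH.cube a L) φ v μ p →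
      (∀ t ∈ Set.Ioo 0 T, NSCH.IsPeriodic L (φ t) ∧ NSCH.IsPeriodic L (v t) ∧
        NSCH.IsPeriodic L (μ t) ∧ NSCH.IsPeriodic L (p t)) →
      ∀ t ∈ Set.Ioo 0 T,
        NSCH.WeakFormulation P (NSCH.cube a L) {ψ | ContDiff ℝ ∞ ψ ∧ NSCH.IsPeriodic L ψ}
          {w | ContDiff ℝ ∞ w ∧ NSCH.IsPeriodic L w} φ v μ p t ∧
        NSCH.MassConserved (NSCH.cube a L) φ t ∧
        NSCH.DensityConserved P (NSCH.cube a L) φ t ∧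
        (P.g = 0 → NSCH.EnergyLaw P (NSCH.cube a L) φ v μ p t)) := by
  have h1le : (1 : WithTop ℕ∞) ≤ ∞ := WithTop.coe_le_coe.mpr le_top
  constructor
  · intro Ω Γ₁ Γ₂ hΩ h hb t ht
    have hnormal : ∀ w, NSCH.NoPenetration Ω Γ₁ Γ₂ w → ∀ x n, NSCH.IsOutwardNormal Ω x n →
        inner ℝ (w x) n = 0 := by
      intro w hw x n hn
      have hx : x ∈ Γ₁ ∪ Γ₂ := by rw [hb.cover]; exact hn.1
      rcases hx with hx | hx
      · rw [hw.1 x hx, inner_zero_left]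
      · exact hw.2 x hx n hn
    have hv := hnormal _ (hb.velocity t ht)
    have key := h.conclusions hΩ.isOpen hΩ.isBounded ht (V := {ψ | ContDiff ℝ ∞ ψ})
      (X := {w | ContDiff ℝ ∞ w ∧ NSCH.NoPenetration Ω Γ₁ Γ₂ w})
      (N := fun F => ∀ x n, NSCH.IsOutwardNormal Ω x n → inner ℝ (F x) n = 0)
      (fun F hF hN => NSCH.setIntegral_vdiv_eq_zero_of_tangential hΩ hF hN)
      (fun ψ (hψ : ContDiff ℝ ∞ ψ) => hψ.of_le h1le) (fun w hw => hw.1.of_le h1le)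
      (fun ψ _ x n hn => by rw [real_inner_smul_left, hv x n hn, mul_zero])
      (fun ψ _ x n hn => by
        rw [real_inner_smul_left, real_inner_smul_left, hv x n hn, mul_zero, mul_zero])
      (fun ψ _ x n hn => by rw [real_inner_smul_left, hb.flux t ht x n hn, mul_zero])
      (fun ψ _ x n hn => by rw [real_inner_smul_left, hb.phase t ht x n hn, mul_zero])
      (fun w hw x n hn => by rw [real_inner_smul_left, hnormal w hw.2 x n hn, mul_zero])
      (fun w _ x n hn => by
        rw [real_inner_smul_left, real_inner_smul_left, hv x n hn, mul_zero, mul_zero])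
      (fun w hw x n hn => by
        rw [NSCH.inner_transposeApply]
        have hx : x ∈ Γ₁ ∪ Γ₂ := by rw [hb.cover]; exact hn.1
        rcases hx with hx | hx
        · rw [hw.2.1 x hx, inner_zero_right]
        -- On Γ₂ the test field w is itself tangential, so it serves as the direction τ.
        · exact hb.free_slip t ht x hx n hn _ (hw.2.2 x hx n hn))
      (contDiff_const : ContDiff ℝ ∞ fun _ : NSCH.Vec d => (1 : ℝ))
      (h.smooth_μ.slice ht) (h.smooth_p.slice ht) (h.smooth_φ.dt.slice ht)
      ⟨h.smooth_v.slice ht, hb.velocity t ht⟩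
    -- Scalar test functions carry no boundary condition here, so y is admissible and g is
    -- arbitrary.
    exact ⟨key.1, key.2.1, key.2.2.1, key.2.2.2 (Or.inr (P.contDiff_y : ContDiff ℝ ∞ P.y))⟩
  · intro a L hL h hper t ht
    obtain ⟨hφ, hv, hμ, hp⟩ := hper t ht
    have hJ : NSCH.IsPeriodic L (P.flux (φ t) (P.pot (μ t) (p t))) :=
      hφ.flux fun x k => by simp only [NSCH.Data.pot, hμ x k, hp x k]
    have key := h.conclusions (NSCH.isOpen_cube a L) (NSCH.isBounded_cube a L) ht
      (V := {ψ | ContDiff ℝ ∞ ψ ∧ NSCH.IsPeriodic L ψ})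
      (X := {w | ContDiff ℝ ∞ w ∧ NSCH.IsPeriodic L w}) (N := NSCH.IsPeriodic L)
      (fun F hF hN => NSCH.setIntegral_vdiv_eq_zero_of_isPeriodic (by omega) a hL hF hN)
      (fun ψ hψ => hψ.1.of_le h1le) (fun w hw => hw.1.of_le h1le)
      (fun ψ hψ x k => by simp only [hψ.2 x k, hv x k])
      (fun ψ hψ x k => by simp only [hψ.2 x k, hφ x k, hv x k])
      (fun ψ hψ x k => by simp only [hψ.2 x k, hJ x k])
      (fun ψ hψ x k => by simp only [hψ.2 x k, hφ.gradient x k])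
      (fun w hw x k => by simp only [hw.2 x k, hp x k])
      (fun w hw x k => by simp only [hw.2 x k, hv x k, hφ x k])
      (fun w hw x k => by
        simp only [NSCH.transposeApply, hw.2 x k, (hφ.stress hv : NSCH.IsPeriodic L _) x k])
      ⟨contDiff_const, fun _ _ => rfl⟩ ⟨h.smooth_μ.slice ht, hμ⟩ ⟨h.smooth_p.slice ht, hp⟩
      -- The time derivative inherits periodicity because φ is periodic at all times near t.
      ⟨h.smooth_φ.dt.slice ht, fun x k => by
        refine Filter.EventuallyEq.deriv_eq ?_
        filter_upwards [isOpen_Ioo.mem_nhds ht] with s hs using (hper s hs).1 x k⟩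
      ⟨h.smooth_v.slice ht, hv⟩
    -- The height y is not periodic, which is why g = 0 is used here.
    exact ⟨key.1, key.2.1, key.2.2.1, fun hg => key.2.2.2 (Or.inl hg)⟩
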